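/- Let $N$ be a finite nonempty set of voters and $C$ a finite nonempty set of candidates. A profile $P$ gives each voter $i\in N$ a strict total order $\succ_i$ on $C$. For $S\subseteq C$, $\mathrm{top}(i,S)$, $\mathrm{second}(i,S)$, $\mathrm{bottom}(i,S)$ denote $i$'s best, second-best and worst candidate in $S$; $\mathrm{top}(i)=\mathrm{top}(i,C)$. For a tree $T$ with vertex set $C$, $P$ is single-peaked on $T$ if for all $i\in N$ and all $a\neq b$ in $C$ such that $b$ lies on the path from $\mathrm{top}(i)$ to $a$ in $T$, we have $b\succ_i a$. Let $\mathcal T(P)$ be the set of all trees on which $P$ is single-peaked. An attachment digraph $D=(C,A)$ of $P$ is obtained as follows. Start with $A=\emptyset$ and $S=C$. While $|S|\ge 3$: let $L=\{\mathrm{bottom}(i,S): i\in N\}$; for each $a\in L$ let $B(a)=\bigcap_{i\in N}B(i,S,a)$, where $B(i,S,a)=\{c\in S: c\succ_i a\}$ if $\mathrm{top}(i,S)\ne a$, and $B(i,S,a)=\{\mathrm{second}(i,S)\}$ otherwise; if $B(a)=\emptyset$ for some $a\in L$, then fail; otherwise add the arcs $(a,b)$ for all $a\in L$, $b\in B(a)$,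 and replace $S$ by $S\setminus L$. In the end, if $|S|=2$, add an arc between the two candidates of $S$, directed arbitrarily. If $t$ is a sink of $D$ (a vertex without outgoing arcs), an attachment function is a map $f:C\setminus\{t\}\to C$ with $(a,f(a))\in A$ for all $a$, and $T(f)$ is the graph on $C$ with edge set $\{\{a,f(a)\}: a\in C\setminus\{t\}\}$. For an integer $k\ge1$, let $H$ be the flow network with vertex set $\{x,z\}\cup\{\ell_a: a\in C\setminus\{t\}\}\cup\{r_a: a\in C\}$, source $x$, sink $z$, and arcs $(x,\ell_a)$ of capacity $1$ for $a\in C\setminus\{t\}$, $(\ell_a,r_b)$ of capacity $1$ for $(a,b)\in A$, $(r_a,z)$ of capacity $k-1$ for $a\in C\setminus\{t\}$, and $(r_t,z)$ of capacity $k$. The algorithm, on input $(P,k)$, builds an attachment digraph $D$ of $P$ (and answers "no" if this fails), takes its sink $t$, and computes an integral flow of maximum value in $H$. If its value is $|C|-1$, the algorithm returns $T(f)$, where $f(a)=b$ for each saturated arc $(\ell_a,r_b)$; otherwise it answers "no". Proposition. 1. $P$ has an attachment digraph (the construction does not fail) if and only if $\mathcal T(P)\ne\emptyset$, and every attachment digraph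 $D$ of $P$ has exactly one sink $t$. For every such $D$ and every integer $k\ge 1$, each integral flow of value $|C|-1$ in $H$ determines an attachment function $f$ (with $f(a)=b$ if and only if $(a,b)\in A$ and the arc $(\ell_a,r_b)$ is saturated), and mapping the flow to $T(f)$ is a bijection from the integral flows of value $|C|-1$ in $H$ to the trees in $\mathcal T(P)$ of maximum degree at most $k$. 2. For every $k\ge1$ the algorithm has an answer on input $(P,k)$. Every tree that it returns belongs to $\mathcal T(P)$ and has maximum degree at most $k$, and if it answers "no", then there is no such tree. 3. The algorithm runs in polynomial time: there are a program for a random access machine (unit cost; the only arithmetic operations are addition and truncated subtraction) and a polynomial $p$ such that for all $P$ and $k\ge1$ the program, given $|N|$, $|C|$, $k$ and the positions $\mathrm{pos}(i,a)=|\{b\in C:b\succ_i a\}|+1$, halts after at most $p(|N|+|C|)$ steps with an answer that the algorithm can give on input $(P,k)$, a tree being output by its adjacency matrix. -/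

import Mathlib

namespace SinglePeakedTree

/-! ### Preference profiles and single-peakedness on a tree -/

/-- A preference profile: every voter `i : N` has a strict total order on the candidates `C`;
`P.prefers i a b` means `a ≻ᵢ b`. -/
structure Profile (N C : Type*) where
  prefers : N → C → C → Prop
  strictTotal : ∀ i, IsStrictTotalOrder C (prefers i)

namespace Profile

variable {N C : Type*} (P : Profile N C)

/-- The position of candidate `a` in the order of voter `i` (positions start at `1`). -/
noncomputable def pos (i : N) (a : C) : ℕ := {b : C | P.prefers i b a}.ncard + 1

/-- `a = top(i, S)`. -/
def IsTop (i : N) (S : Finset C) (a : C) : Prop :=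
  a ∈ S ∧ ∀ b ∈ S, b ≠ a → P.prefers i a b

/-- `a = second(i, S)`. -/
def IsSecond (i : N) (S : Finset C) (a : C) : Prop :=
  a ∈ S ∧ ∃ c, P.IsTop i S c ∧ c ≠ a ∧ ∀ b ∈ S, b ≠ a → b ≠ c → P.prefers i a b

/-- `a = bottom(i, S)`. -/
def IsBottom (i : N) (S : Finset C) (a : C) : Prop :=
  a ∈ S ∧ ∀ b ∈ S, b ≠ a → P.prefers i b a

variable [Fintype C]

/-- `P` is single-peaked on the tree `T`: whenever `b ≠ a` lies on the path in `T` from `top(i)`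
to `a`, voter `i` prefers `b` to `a`. (That `top(i) ≻ᵢ b` unless `b = top(i)` is automatic.) -/
def SinglePeakedOn (T : SimpleGraph C) : Prop :=
  ∀ (i : N) (t a b : C), P.IsTop i Finset.univ t → a ≠ b →
    (∃ p : T.Walk t a, p.IsPath ∧ b ∈ p.support) → P.prefers i b a

/-- `𝒯(P)`, the set of all trees on `C` on which `P` is single-peaked. -/
def trees : Set (SimpleGraph C) := {T | T.IsTree ∧ P.SinglePeakedOn T}

open Classical in
/-- The trees in `𝒯(P)` of maximum degree at most `k`. -/
noncomputable def treesMaxDegree (k : ℕ) : Set (SimpleGraph C) :=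
  {T | T ∈ P.trees ∧ T.maxDegree ≤ k}

/-! ### The attachment digraph -/

open Classical in
/-- The candidates of `S` that some voter ranks last within `S`. -/
noncomputable def bottoms (S : Finset C) : Finset C :=
  S.filter fun a => ∃ i, P.IsBottom i S a

open Classical in
/-- `B(a) = ⋂ᵢ B(i, S, a)`, where `B(i, S, a)` is `{second(i, S)}` if `top(i, S) = a`, and
`{c ∈ S : c ≻ᵢ a}` otherwise. -/
noncomputable def attachSet (S : Finset C) (a : C) : Finset C :=
  S.filter fun c => ∀ i,
    (P.IsTop i S a → P.IsSecond i S c) ∧ (¬ P.IsTop i S a → P.prefers i c a)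

open Classical in
/-- `P.AttachmentRun S D`: starting with `S` as the set of remaining candidates, the construction
of the attachment digraph terminates without failure, and the arcs it adds from then on are exactly
those of `D`. When two candidates remain, the arc between them is directed arbitrarily. -/
inductive AttachmentRun : Finset C → Digraph C → Prop
  | single (S : Finset C) : S.card ≤ 1 → AttachmentRun S ⟨fun _ _ => False⟩
  | pair (a b : C) : a ≠ b → AttachmentRun {a, b} ⟨fun x y => x = a ∧ y = b⟩
  | step (S : Finset C) (D : Digraph C) : 3 ≤ S.card →
      (∀ a ∈ P.bottoms S, (P.attachSet S a).Nonempty) →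
      AttachmentRun (S \ P.bottoms S) D →
      AttachmentRun S
        ⟨fun x y => (x ∈ P.bottoms S ∧ y ∈ P.attachSet S x) ∨ D.Adj x y⟩

/-- `D` is an attachment digraph of `P`, i.e. a possible result of the construction on all of `C`
(it is unique up to the direction of the arc between the last two candidates). -/
def IsAttachmentDigraph (D : Digraph C) : Prop := P.AttachmentRun Finset.univ D

end Profile

/-- `t` is a sink of `D`: it has no outgoing arc. -/
def IsSink {C : Type*} (D : Digraph C) (t : C) : Prop := ∀ b, ¬ D.Adj t b

/-- `f : C \ {t} → C` is an attachment function for `D`. -/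
def IsAttachmentFunction {C : Type*} (D : Digraph C) (t : C) (f : {a : C // a ≠ t} → C) : Prop :=
  ∀ a : {a : C // a ≠ t}, D.Adj a.1 (f a)

/-- The graph `T(f)` with edge set `{ {a, f a} : a ∈ C \ {t} }`. -/
def treeOf {C : Type*} (t : C) (f : {a : C // a ≠ t} → C) : SimpleGraph C :=
  SimpleGraph.fromRel fun a b => ∃ h : a ≠ t, f ⟨a, h⟩ = b

/-! ### Flow networks and integral flows -/

/-- A flow network on vertex set `V` with capacities in `ℕ`. -/
structure FlowNetwork (V : Type*) where
  source : V
  sink : V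
  Arc : V → V → Prop
  cap : V → V → ℕ

namespace FlowNetwork

variable {V : Type*} [Fintype V] (H : FlowNetwork V)

/-- `g` is an integral flow in `H`: it is supported on the arcs, obeys the capacities, and is
conserved at all vertices other than the source and the sink. -/
structure IsFlow (g : V → V → ℕ) : Prop where
  eq_zero : ∀ u v, ¬ H.Arc u v → g u v = 0
  le_cap : ∀ u v, H.Arc u v → g u v ≤ H.cap u v
  conserved : ∀ v, v ≠ H.source → v ≠ H.sink → ∑ u, g u v = ∑ w, g v w

/-- The value (size) of a flow: the net amount that leaves the source. -/
def value (g : V → V → ℕ) : ℤ := ∑ v, (g H.source v : ℤ) - ∑ v, (g v H.source : ℤ)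

/-- `g` is an integral flow of maximum value. -/
def IsMaximumFlow (g : V → V → ℕ) : Prop :=
  H.IsFlow g ∧ ∀ g', H.IsFlow g' → H.value g' ≤ H.value g

end FlowNetwork

/-- The vertex set `{x, z} ∪ L ∪ R` of the network, where `L = {ℓ_a : a ∈ C \ {t}}` and
`R = {r_a : a ∈ C}`. -/
inductive NetVertex (C : Type*) (t : C)
  | x : NetVertex C t
  | z : NetVertex C t
  | l : {a : C // a ≠ t} → NetVertex C t
  | r : C → NetVertex C t

/-- The network vertices as a disjoint union; needed only to see that there are finitely many. -/
def NetVertex.equiv (C : Type*) (t : C) : NetVertex C t ≃ Bool ⊕ ({a : C // a ≠ t} ⊕ C) where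
  toFun
    | .x => Sum.inl true
    | .z => Sum.inl false
    | .l a => Sum.inr (Sum.inl a)
    | .r a => Sum.inr (Sum.inr a)
  invFun
    | Sum.inl true => .x
    | Sum.inl false => .z
    | Sum.inr (Sum.inl a) => .l a
    | Sum.inr (Sum.inr a) => .r a
  left_inv v := by cases v <;> rfl
  right_inv v := by rcases v with (_ | _) | _ | _ <;> rfl

open Classical in
noncomputable instance {C : Type*} [Fintype C] (t : C) : Fintype (NetVertex C t) :=
  Fintype.ofEquiv _ (NetVertex.equiv C t).symm

open Classical in
/-- The network `H` for the digraph `D` with sink `t` and degree bound `k`. The value of `cap` on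
pairs that are not arcs is irrelevant. -/
noncomputable def degreeNetwork {C : Type*} (D : Digraph C) (t : C) (k : ℕ) :
    FlowNetwork (NetVertex C t) where
  source := .x
  sink := .z
  Arc
    | .x, .l _ => True
    | .l a, .r b => D.Adj a.1 b
    | .r _, .z => True
    | _, _ => False
  cap
    | .x, .l _ => 1
    | .l _, .r _ => 1
    | .r a, .z => if a = t then k else k - 1
    | _, _ => 0

/-- The attachment function `f` is read off the flow `g`: `f a = b` exactly when `(a, b)` is an arc
of `D` and the arc `(ℓ_a, r_b)` is saturated by `g`. -/
def ReadOff {C : Type*} (D : Digraph C) (t : C) (k : ℕ) (g : NetVertex C t → NetVertex C t → ℕ)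
    (f : {a : C // a ≠ t} → C) : Prop :=
  IsAttachmentFunction D t f ∧
    ∀ (a : {a : C // a ≠ t}) (b : C), f a = b ↔
      (D.Adj a.1 b ∧ g (.l a) (.r b) = (degreeNetwork D t k).cap (.l a) (.r b))

/-- The integral flows of value `|C| - 1` in the network. -/
def fullFlows {C : Type*} [Fintype C] (D : Digraph C) (t : C) (k : ℕ) :
    Set (NetVertex C t → NetVertex C t → ℕ) :=
  {g | (degreeNetwork D t k).IsFlow g ∧
    (degreeNetwork D t k).value g = (Fintype.card C : ℤ) - 1}

/-- `DegreeAlgorithmReturns P k r`: on input `(P, k)` the flow-based algorithm can return `r`, where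
`some T` stands for the tree `T`, and `none` for the answer that no suitable tree exists. The
algorithm builds the attachment digraph `D` (and answers negatively if this construction fails),
takes its sink `t`, computes a maximum flow `g`, and compares its value with `|C| - 1`. -/
inductive DegreeAlgorithmReturns {N C : Type*} [Fintype C] (P : Profile N C) (k : ℕ) :
    Option (SimpleGraph C) → Prop
  | fail : (¬ ∃ D, P.IsAttachmentDigraph D) → DegreeAlgorithmReturns P k none
  | tree (D : Digraph C) (t : C) (g : NetVertex C t → NetVertex C t → ℕ)
      (f : {a : C // a ≠ t} → C) :
      P.IsAttachmentDigraph D → IsSink D t → (degreeNetwork D t k).IsMaximumFlow g →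
      (degreeNetwork D t k).value g = (Fintype.card C : ℤ) - 1 →
      ReadOff D t k g f → DegreeAlgorithmReturns P k (some (treeOf t f))
  | noTree (D : Digraph C) (t : C) (g : NetVertex C t → NetVertex C t → ℕ) :
      P.IsAttachmentDigraph D → IsSink D t → (degreeNetwork D t k).IsMaximumFlow g →
      (degreeNetwork D t k).value g ≠ (Fintype.card C : ℤ) - 1 →
      DegreeAlgorithmReturns P k none

/-! ### A random access machine with a step count

Programs are finite terms of a small imperative language. They work on registers and
two-dimensional arrays that hold natural numbers; each program names finitely many of them. The only arithmetic operations are addition and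
truncated subtraction, so that the bit length of all numbers grows by at most a constant per step,
and polynomially many steps are polynomial time in the usual sense. -/

/-- A memory state: the contents of the registers and of the cells of the arrays. -/
structure State where
  reg : ℕ → ℕ
  arr : ℕ → ℕ → ℕ → ℕ

/-- Set register `x` to `v`. -/
def State.setReg (s : State) (x v : ℕ) : State :=
  { s with reg := Function.update s.reg x v }

/-- Set the cell `(i, j)` of array `A` to `v`. -/
def State.setArr (s : State) (A i j v : ℕ) : State :=
  { s with arr :=
      Function.update s.arr A (Function.update (s.arr A) i (Function.update (s.arr A i) j v)) }

/-- Expressions: constants, registers, array cells, sums, and truncated differences. -/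
inductive Expr
  | const : ℕ → Expr
  | reg : ℕ → Expr
  | cell : ℕ → Expr → Expr → Expr
  | add : Expr → Expr → Expr
  | sub : Expr → Expr → Expr

/-- The value of an expression in a state. -/
def Expr.eval (s : State) : Expr → ℕ
  | const n => n
  | reg x => s.reg x
  | cell A i j => s.arr A (i.eval s) (j.eval s)
  | add e₁ e₂ => e₁.eval s + e₂.eval s
  | sub e₁ e₂ => e₁.eval s - e₂.eval s

/-- The number of steps that it takes to evaluate an expression: one for each of its nodes. -/
def Expr.cost : Expr → ℕ
  | const _ => 1
  | reg _ => 1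
  | cell _ i j => i.cost + j.cost + 1
  | add e₁ e₂ => e₁.cost + e₂.cost + 1
  | sub e₁ e₂ => e₁.cost + e₂.cost + 1

/-- Programs. The tests of `ite` and `loop` hold when the expression is nonzero. -/
inductive Program
  | skip : Program
  | assign : ℕ → Expr → Program
  | store : ℕ → Expr → Expr → Expr → Program
  | seq : Program → Program → Program
  | ite : Expr → Program → Program → Program
  | loop : Expr → Program → Program

/-- `Exec c s n s'`: started in state `s`, the program `c` halts after exactly `n` steps in
state `s'`. -/
inductive Exec : Program → State → ℕ → State → Prop
  | skip (s : State) : Exec .skip s 1 s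
  | assign (x : ℕ) (e : Expr) (s : State) :
      Exec (.assign x e) s (e.cost + 1) (s.setReg x (e.eval s))
  | store (A : ℕ) (i j e : Expr) (s : State) :
      Exec (.store A i j e) s (i.cost + j.cost + e.cost + 1)
        (s.setArr A (i.eval s) (j.eval s) (e.eval s))
  | seq {c d : Program} {s s' s'' : State} {n n' : ℕ} :
      Exec c s n s' → Exec d s' n' s'' → Exec (.seq c d) s (n + n' + 1) s''
  | iteTrue {e : Expr} {c d : Program} {s s' : State} {n : ℕ} :
      e.eval s ≠ 0 → Exec c s n s' → Exec (.ite e c d) s (e.cost + n + 1) s'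
  | iteFalse {e : Expr} {c d : Program} {s s' : State} {n : ℕ} :
      e.eval s = 0 → Exec d s n s' → Exec (.ite e c d) s (e.cost + n + 1) s'
  | loopDone {e : Expr} {c : Program} {s : State} :
      e.eval s = 0 → Exec (.loop e c) s (e.cost + 1) s
  | loopStep {e : Expr} {c : Program} {s s' s'' : State} {n n' : ℕ} :
      e.eval s ≠ 0 → Exec c s n s' → Exec (.loop e c) s' n' s'' →
      Exec (.loop e c) s (e.cost + n + n' + 1) s''

/-- The input state for a profile with `n` voters and `m` candidates, and the number `k`: registers
`0, 1, 2` hold `n, m, k`, and the cell `(i, a)` of array `0` holds `pos(i, a)`; everything else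
is `0`. -/
noncomputable def inputState {n m : ℕ} (P : Profile (Fin n) (Fin m)) (k : ℕ) : State where
  reg := fun x => if x = 0 then n else if x = 1 then m else if x = 2 then k else 0
  arr := fun A i a =>
    if h : A = 0 ∧ i < n ∧ a < m then P.pos ⟨i, h.2.1⟩ ⟨a, h.2.2⟩ else 0

/-- The final state `s` presents the answer `r`: register `0` tells whether there is a tree, and if
so, array `1` holds its adjacency matrix. -/
def Presents {m : ℕ} (s : State) : Option (SimpleGraph (Fin m)) → Prop
  | none => s.reg 0 = 0
  | some T => s.reg 0 = 1 ∧
      ∀ a b : Fin m, (T.Adj a b → s.arr 1 a b = 1) ∧ (¬ T.Adj a b → s.arr 1 a b = 0)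

end SinglePeakedTree

open SinglePeakedTree

namespace SinglePeakedTree

/-! ### Single-peakedness as a local condition -/

section

namespace Profile

variable {N C : Type*} (P : Profile N C)

/-! Single-peakedness on a tree is a local condition: at every candidate other than the top one,
each voter sees exactly one better neighbour (`mem_trees_iff`). In this form it makes sense on every
subset `S`, so candidates can be peeled off. If some voter ranks `a` last in `S`, all neighbours of
`a` are better for that voter, so `a` is a leaf, and the other voters confine its neighbour to the
attachment set (`HasUniqueBetterNeighbor.exists_leaf`). Removing such leaves keeps the condition,
and so does attaching them to arbitrary members of their attachment sets
(`HasUniqueBetterNeighbor.sdiff`, `HasUniqueBetterNeighbor.of_sdiff`). By induction the trees in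
`𝒯(P)` are exactly the graphs `T(f)` (`PeelRun.hasUniqueBetterNeighbor_iff`, `isAttached_iff`). The
induction runs over `PeelRun`, which covers both the removal of whole layers in the definition and
the removal of single candidates in the program.

Arcs lead to candidates that survive longer, so no two arcs are opposite. Hence `f` can be recovered
from `T(f)`, and the degree of `b` is the number of candidates attached to it, plus one unless `b`
is the sink; bounding the degree by `k` is bounding these loads by the capacities of the network. A
flow of value `|C| - 1` saturates all arcs at the source, so every `ℓ_a` passes its unit on to a
single `r_b`, and the flow is nothing but such an `f` (`eq_flowOf`).

For the running time, every suitable tree is a possible output of the flow algorithm, and "no" is a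
possible output whenever there is none (`degreeAlgorithmReturns_some`,
`degreeAlgorithmReturns_none`). The program may therefore find the assignment in its own way. It
attaches every removed candidate to some admissible one and then balances the loads by pushing and
relabelling. A potential of cubic size bounds the number of rounds, and an overloaded candidate
whose label reaches `|C|` certifies by a counting argument that no assignment exists
(`IsValidLabelling.not_exists`). The loop bodies are loop-free blocks with bounded sums, compiled
once and for all; `Block.simulates_loop` turns a decreasing invariant into a time bound. -/

theorem prefers_irrefl (i : N) (a : C) : ¬ P.prefers i a a :=
  (P.strictTotal i).irrefl a

theorem prefers_trans {i : N} {a b c : C} (hab : P.prefers i a b) (hbc : P.prefers i b c) :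
    P.prefers i a c :=
  (P.strictTotal i).trans a b c hab hbc

theorem prefers_asymm {i : N} {a b : C} (hab : P.prefers i a b) : ¬ P.prefers i b a :=
  fun hba => P.prefers_irrefl i a (P.prefers_trans hab hba)

theorem prefers_ne {i : N} {a b : C} (hab : P.prefers i a b) : a ≠ b := by
  rintro rfl
  exact P.prefers_irrefl i a hab

theorem prefers_or_prefers (i : N) {a b : C} (h : a ≠ b) : P.prefers i a b ∨ P.prefers i b a := by
  by_contra! hc
  exact h ((P.strictTotal i).trichotomous a b hc.1 hc.2)

theorem wellFounded_prefers [Finite C] (i : N) : WellFounded (P.prefers i) := by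
  have := P.strictTotal i
  exact Finite.wellFounded_of_trans_of_irrefl _

theorem wellFounded_prefers_swap [Finite C] (i : N) : WellFounded (Function.swap (P.prefers i)) := by
  have := P.strictTotal i
  exact Finite.wellFounded_of_trans_of_irrefl _

theorem exists_isTop [Finite C] (i : N) {S : Finset C} (hS : S.Nonempty) : ∃ a, P.IsTop i S a := by
  obtain ⟨a, ha, h⟩ := (P.wellFounded_prefers i).has_min (S : Set C) hS
  exact ⟨a, ha, fun b hb hba => (P.prefers_or_prefers i hba).resolve_left (h b hb)⟩

theorem exists_isBottom [Finite C] (i : N) {S : Finset C} (hS : S.Nonempty) :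
    ∃ a, P.IsBottom i S a := by
  obtain ⟨a, ha, h⟩ := (P.wellFounded_prefers_swap i).has_min (S : Set C) hS
  exact ⟨a, ha, fun b hb hba => (P.prefers_or_prefers i hba).resolve_right (h b hb)⟩

variable {P}

theorem IsTop.eq {i : N} {S : Finset C} {a b : C} (ha : P.IsTop i S a) (hb : P.IsTop i S b) :
    a = b := by
  by_contra h
  exact P.prefers_asymm (ha.2 b hb.1 (Ne.symm h)) (hb.2 a ha.1 h)

theorem IsTop.mono {i : N} {S S' : Finset C} {a : C} (h : P.IsTop i S a) (hS : S' ⊆ S)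
    (ha : a ∈ S') : P.IsTop i S' a :=
  ⟨ha, fun b hb => h.2 b (hS hb)⟩

theorem not_isTop_iff [Finite C] {i : N} {S : Finset C} {a : C} (ha : a ∈ S) :
    ¬ P.IsTop i S a ↔ ∃ b ∈ S, P.prefers i b a := by
  constructor
  · intro h
    obtain ⟨t, ht⟩ := P.exists_isTop i ⟨a, ha⟩
    have : t ≠ a := by rintro rfl; exact h ht
    exact ⟨t, ht.1, ht.2 a ha this.symm⟩
  · rintro ⟨b, hb, hba⟩ h
    exact P.prefers_asymm hba (h.2 b hb (P.prefers_ne hba))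

variable (P)

/-- Within `S`, every candidate `a` that is not the top of voter `i` has exactly one neighbour that
`i` prefers to `a`. For `S = C` this characterizes the trees on which `P` is single-peaked. -/
def HasUniqueBetterNeighbor (S : Finset C) (T : SimpleGraph C) : Prop :=
  ∀ i, ∀ a ∈ S, ¬ P.IsTop i S a → ∃! b, b ∈ S ∧ T.Adj a b ∧ P.prefers i b a

theorem bottoms_subset (S : Finset C) : P.bottoms S ⊆ S := by
  classical
  exact Finset.filter_subset _ _

theorem attachSet_subset (S : Finset C) (a : C) : P.attachSet S a ⊆ S := by
  classical
  exact Finset.filter_subset _ _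

variable [Fintype C] {P}

/-- The first vertex on the path from `a` to the top is a better neighbour. For any better neighbour
`y`, the path from `y` to the top avoids `a`, so it extends to a path from `a`; paths in a tree are
unique, so `y` is that first vertex. -/
theorem SinglePeakedOn.hasUniqueBetterNeighbor {T : SimpleGraph C} (hT : T.IsTree)
    (h : P.SinglePeakedOn T) : P.HasUniqueBetterNeighbor Finset.univ T := by
  classical
  intro i a ha hnt
  obtain ⟨t, ht⟩ := P.exists_isTop i ⟨a, ha⟩
  have hta : t ≠ a := by rintro rfl; exact hnt ht
  obtain ⟨q, hq⟩ := hT.connected.exists_isPath a t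
  cases q with
  | nil => exact absurd rfl hta
  | @cons _ b _ hab q' =>
    have hb : P.prefers i b a := by
      refine h i t a b ht hab.ne ⟨(SimpleGraph.Walk.cons hab q').reverse, hq.reverse, ?_⟩
      simp
    refine ⟨b, ⟨Finset.mem_univ _, hab, hb⟩, ?_⟩
    rintro y ⟨-, hay, hy⟩
    obtain ⟨r, hr⟩ := hT.connected.exists_isPath y t
    have har : a ∉ r.support := fun har =>
      P.prefers_asymm hy (h i t y a ht hay.ne.symm ⟨r.reverse, hr.reverse, by simpa using har⟩)
    have hp : (SimpleGraph.Walk.cons hay r).IsPath := hr.cons har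
    have := (hT.isAcyclic.subsingleton_path _ _).elim ⟨_, hq⟩ ⟨_, hp⟩
    have := congrArg (fun p : T.Path a t => p.1.getVert 1) this
    simpa using this.symm

/-- Moving to the better neighbour again and again improves strictly, so no candidate is repeated
and the walk can stop only at the top. -/
theorem HasUniqueBetterNeighbor.exists_path {T : SimpleGraph C}
    (h : P.HasUniqueBetterNeighbor Finset.univ T) {i : N} {t : C} (ht : P.IsTop i Finset.univ t)
    (a : C) : ∃ p : T.Walk a t, p.IsPath ∧ ∀ b ∈ p.support, b ≠ a → P.prefers i b a := by
  induction a using (P.wellFounded_prefers i).induction with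
  | _ a ih =>
    by_cases hat : a = t
    · subst hat
      exact ⟨.nil, .nil, by simp⟩
    · obtain ⟨b, ⟨-, hab, hb⟩, -⟩ := h i a (Finset.mem_univ _) fun h' => hat (h'.eq ht)
      obtain ⟨p, hp, hpb⟩ := ih b hb
      have key : ∀ c ∈ p.support, P.prefers i c a := by
        intro c hc
        by_cases hcb : c = b
        · rwa [hcb]
        · exact P.prefers_trans (hpb c hc hcb) hb
      refine ⟨.cons hab p, hp.cons fun hap => P.prefers_irrefl i a (key a hap), ?_⟩
      intro c hc hca
      rw [SimpleGraph.Walk.support_cons, List.mem_cons] at hc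
      exact key c (hc.resolve_left hca)

/-- For a fixed voter, improving walks connect everything to the top. Sending a candidate to the
edge towards its better neighbour is a bijection from the candidates other than the top to the
edges, which gives the edge count of a tree. -/
theorem HasUniqueBetterNeighbor.isTree [Nonempty N] [Nonempty C] {T : SimpleGraph C}
    (h : P.HasUniqueBetterNeighbor Finset.univ T) : T.IsTree := by
  classical
  obtain ⟨i⟩ := ‹Nonempty N›
  obtain ⟨t, ht⟩ := P.exists_isTop i (Finset.univ_nonempty (α := C))
  have hnt : ∀ a, a ≠ t → ¬ P.IsTop i Finset.univ a := fun a hat h' => hat (h'.eq ht)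
  rw [SimpleGraph.isTree_iff_connected_and_card]
  constructor
  · have hr : ∀ a, T.Reachable a t := fun a => ⟨(h.exists_path ht a).choose⟩
    exact ⟨fun a b => (hr a).trans (hr b).symm⟩
  · choose g hg hgu using fun a : {a // a ≠ t} => h i a.1 (Finset.mem_univ _) (hnt a.1 a.2)
    let φ : {a // a ≠ t} → T.edgeSet := fun a => ⟨s(a.1, g a), (hg a).2.1⟩
    have hφ : Function.Bijective φ := by
      constructor
      · intro a a' haa
        have := congrArg Subtype.val haa
        simp only [φ, Sym2.eq_iff] at this
        rcases this with ⟨h1, -⟩ | ⟨h1, h2⟩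
        · exact Subtype.ext h1
        · have h3 := (hg a).2.2
          have h4 := (hg a').2.2
          rw [← h1] at h4
          rw [h2] at h3
          exact absurd h3 (P.prefers_asymm h4)
      · have key : ∀ x y, T.Adj x y → P.prefers i x y → ∃ a, (φ a).1 = s(x, y) := by
          intro x y hxy hp
          have hyt : y ≠ t := by
            rintro rfl
            exact P.prefers_asymm hp (ht.2 x (Finset.mem_univ _) hxy.ne)
          refine ⟨⟨y, hyt⟩, ?_⟩
          have := hgu ⟨y, hyt⟩ x ⟨Finset.mem_univ _, hxy.symm, hp⟩
          simp only [φ, ← this]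
          exact Sym2.eq_swap
        rintro ⟨e, he⟩
        induction e using Sym2.ind with
        | _ x y =>
          rw [SimpleGraph.mem_edgeSet] at he
          rcases P.prefers_or_prefers i he.ne with hp | hp
          · obtain ⟨a, ha⟩ := key x y he hp
            exact ⟨a, Subtype.ext ha⟩
          · obtain ⟨a, ha⟩ := key y x he.symm hp
            exact ⟨a, Subtype.ext (ha.trans Sym2.eq_swap)⟩
    rw [← Nat.card_eq_of_bijective φ hφ, Nat.card_eq_fintype_card, Nat.card_eq_fintype_card,
      Fintype.card_subtype_compl, Fintype.card_subtype_eq]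
    exact Nat.sub_add_cancel (Fintype.card_pos_iff.2 ⟨t⟩)

theorem HasUniqueBetterNeighbor.singlePeakedOn {T : SimpleGraph C} (hT : T.IsTree)
    (h : P.HasUniqueBetterNeighbor Finset.univ T) : P.SinglePeakedOn T := by
  intro i t a b ht hab ⟨p, hp, hb⟩
  obtain ⟨q, hq, hqa⟩ := h.exists_path ht a
  have := congrArg Subtype.val ((hT.isAcyclic.subsingleton_path _ _).elim ⟨p, hp⟩ ⟨q.reverse, hq.reverse⟩)
  dsimp only at this
  subst this
  exact hqa b (by simpa using hb) hab.symm

theorem mem_trees_iff [Nonempty N] [Nonempty C] {T : SimpleGraph C} :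
    T ∈ P.trees ↔ P.HasUniqueBetterNeighbor Finset.univ T :=
  ⟨fun h => h.2.hasUniqueBetterNeighbor h.1, fun h => ⟨h.isTree, h.singlePeakedOn h.isTree⟩⟩

/-- Both cases in the definition of `B(i, S, a)` become one disjunction: if `a` is not the top,
something beats `a`, and a candidate that beats everything else then beats `a` as well. A voter is
needed for `b ≠ a`, since an empty intersection would be all of `S`. -/
theorem mem_attachSet [Nonempty N] {S : Finset C} {a b : C} (ha : a ∈ S) :
    b ∈ P.attachSet S a ↔ b ∈ S ∧ b ≠ a ∧
      ∀ i, P.prefers i b a ∨ ∀ c ∈ S, c ≠ a → c ≠ b → P.prefers i b c := by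
  classical
  rw [attachSet, Finset.mem_filter]
  refine and_congr_right fun hb => ?_
  constructor
  · intro h
    have hs : ∀ i, P.IsTop i S a → b ≠ a ∧ ∀ c ∈ S, c ≠ a → c ≠ b → P.prefers i b c := by
      intro i ht
      obtain ⟨-, c, hc, hcb, hcs⟩ := (h i).1 ht
      obtain rfl := hc.eq ht
      exact ⟨hcb.symm, fun d hd hda hdb => hcs d hd hdb hda⟩
    refine ⟨?_, fun i => ?_⟩
    · obtain ⟨i⟩ := ‹Nonempty N›
      by_cases ht : P.IsTop i S a
      · exact (hs i ht).1
      · exact P.prefers_ne ((h i).2 ht)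
    · by_cases ht : P.IsTop i S a
      · exact .inr (hs i ht).2
      · exact .inl ((h i).2 ht)
  · rintro ⟨hba, h⟩ i
    constructor
    · intro ht
      refine ⟨hb, a, ht, hba.symm, fun c hc hcb hca => ?_⟩
      exact ((h i).resolve_left (P.prefers_asymm (ht.2 b hb hba))) c hc hca hcb
    · intro ht
      refine (h i).elim id fun h' => ?_
      obtain ⟨c, hc, hca⟩ := (not_isTop_iff ha).1 ht
      by_cases hcb : c = b
      · rwa [← hcb]
      · exact P.prefers_trans (h' c hc (P.prefers_ne hca) hcb) hca

end Profile

end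

/-! ### Peeling off candidates that are ranked last -/

section

namespace Profile

variable {N C : Type*} {P : Profile N C} [Fintype C]

open Classical in
/-- A candidate that some voter ranks last is a leaf of every tree, attached to its attachment
set. -/
theorem HasUniqueBetterNeighbor.exists_leaf [Nonempty N] {S : Finset C} {T : SimpleGraph C}
    (h : P.HasUniqueBetterNeighbor S T) {a c : C} (ha : a ∈ P.bottoms S) (hc : c ∈ S)
    (hca : c ≠ a) : ∃ b ∈ P.attachSet S a, ∀ d ∈ S, T.Adj a d ↔ d = b := by
  obtain ⟨haS, j, hj⟩ := Finset.mem_filter.1 ha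
  obtain ⟨b, ⟨hbS, hab, hb⟩, hbu⟩ :=
    h j a haS ((not_isTop_iff haS).2 ⟨c, hc, hj.2 c hc hca⟩)
  have hleaf : ∀ d ∈ S, T.Adj a d → d = b := fun d hd had =>
    hbu d ⟨hd, had, hj.2 d hd had.ne.symm⟩
  refine ⟨b, (mem_attachSet haS).2 ⟨hbS, hab.ne.symm, fun i => ?_⟩, fun d hd =>
    ⟨hleaf d hd, fun hdb => hdb ▸ hab⟩⟩
  -- If `a` is the favourite of `i`, it is the only candidate better than the runner-up `s`. So it
  -- is the better neighbour of `s`, and since `a` is a leaf, `s` is its neighbour `b`.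
  by_cases ht : P.IsTop i S a
  · right
    obtain ⟨s, hs⟩ := P.exists_isTop i (S := S.erase a) ⟨c, Finset.mem_erase.2 ⟨hca, hc⟩⟩
    have hsS := Finset.mem_erase.1 hs.1
    obtain ⟨y, ⟨hyS, hsy, hy⟩, -⟩ :=
      h i s hsS.2 ((not_isTop_iff hsS.2).2 ⟨a, haS, ht.2 s hsS.2 hsS.1⟩)
    have hya : y = a := by
      by_contra hya
      exact P.prefers_asymm hy (hs.2 y (Finset.mem_erase.2 ⟨hya, hyS⟩) hsy.ne.symm)
    subst hya
    obtain rfl := hleaf s hsS.2 hsy.symm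
    intro d hd hda hds
    exact hs.2 d (Finset.mem_erase.2 ⟨hda, hd⟩) hds
  · left
    obtain ⟨y, ⟨hyS, hay, hy⟩, -⟩ := h i a haS ht
    rwa [← hleaf y hyS hay]

-- The better neighbour `b` of `a` survives unless `a` becomes the top: if `b` is removed, it is a
-- leaf attached to `a`, so `a` lies in its attachment set, and a voter who prefers `b` to `a` must
-- put `a` above everything else.
open Classical in
theorem HasUniqueBetterNeighbor.sdiff [Nonempty N] {S L : Finset C} {T : SimpleGraph C}
    (h : P.HasUniqueBetterNeighbor S T) (hL : L ⊆ P.bottoms S) :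
    P.HasUniqueBetterNeighbor (S \ L) T := by
  intro i a ha hnt
  obtain ⟨haS, haL⟩ := Finset.mem_sdiff.1 ha
  obtain ⟨b, ⟨hbS, hab, hb⟩, hbu⟩ :=
    h i a haS fun ht => hnt (ht.mono Finset.sdiff_subset ha)
  have hbL : b ∉ L := by
    intro hbL
    obtain ⟨e, he, heb⟩ := h.exists_leaf (hL hbL) haS hab.ne
    obtain rfl := (heb a haS).1 hab.symm
    obtain ⟨-, -, h'⟩ := (mem_attachSet hbS).1 he
    rcases h' i with h' | h'
    · exact P.prefers_asymm hb h'
    · refine hnt ⟨ha, fun c hc hca => ?_⟩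
      obtain ⟨hcS, hcL⟩ := Finset.mem_sdiff.1 hc
      exact h' c hcS (by rintro rfl; exact hcL hbL) hca
  exact ⟨b, ⟨Finset.mem_sdiff.2 ⟨hbS, hbL⟩, hab, hb⟩, fun y hy =>
    hbu y ⟨(Finset.mem_sdiff.1 hy.1).1, hy.2⟩⟩

open Classical in
theorem HasUniqueBetterNeighbor.of_sdiff [Nonempty N] {S L : Finset C} {T : SimpleGraph C}
    (h : P.HasUniqueBetterNeighbor (S \ L) T) (hLS : L ⊆ S)
    (hdisj : ∀ a ∈ L, Disjoint (P.attachSet S a) L)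
    (hleaf : ∀ a ∈ L, ∃ b ∈ P.attachSet S a, ∀ d ∈ S, T.Adj a d ↔ d = b) :
    P.HasUniqueBetterNeighbor S T := by
  intro i a haS hnt
  obtain ⟨y, hyS, hya⟩ := (not_isTop_iff haS).1 hnt
  -- A leaf that beats the candidate `a` it hangs on forces `a` to beat all the others. This
  -- excludes a second better neighbour below.
  have hmem : ∀ l ∈ L, T.Adj a l → P.prefers i l a → ∀ c ∈ S, c ≠ l → c ≠ a → P.prefers i a c := by
    intro l hl hal hla
    obtain ⟨b, hb, hlb⟩ := hleaf l hl
    obtain rfl := (hlb a haS).1 hal.symm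
    exact (((mem_attachSet (hLS hl)).1 hb).2.2 i).resolve_left (P.prefers_asymm hla)
  by_cases haL : a ∈ L
  · obtain ⟨b, hb, hab⟩ := hleaf a haL
    obtain ⟨hbS, hba, hbi⟩ := (mem_attachSet haS).1 hb
    refine ⟨b, ⟨hbS, (hab b hbS).2 rfl, (hbi i).elim id fun h' => ?_⟩,
      fun d hd => (hab d hd.1).1 hd.2.1⟩
    by_cases hyb : y = b
    · rwa [← hyb]
    · exact P.prefers_trans (h' y hyS (P.prefers_ne hya) hyb) hya
  · have haSL := Finset.mem_sdiff.2 ⟨haS, haL⟩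
    -- If `a` is the top of `S \ L` but not of `S`, the top `l` of `S` is a removed leaf. Its
    -- neighbour is second best in `S` and hence equals `a`, so `l` is the better neighbour of `a`.
    by_cases ht : P.IsTop i (S \ L) a
    · obtain ⟨l, hl⟩ := P.exists_isTop i (S := S) ⟨a, haS⟩
      have hla : a ≠ l := by rintro rfl; exact hnt hl
      have hlL : l ∈ L := by
        by_contra hlL
        exact hla (ht.eq (hl.mono Finset.sdiff_subset (Finset.mem_sdiff.2 ⟨hl.1, hlL⟩)))
      obtain ⟨b, hb, hlb⟩ := hleaf l hlL
      obtain ⟨hbS, hbl, hbi⟩ := (mem_attachSet hl.1).1 hb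
      have hbL : b ∉ L := Finset.disjoint_left.1 (hdisj l hlL) hb
      have hbi := (hbi i).resolve_left (P.prefers_asymm (hl.2 b hbS hbl))
      have hab : a = b := by
        by_contra hab
        exact P.prefers_asymm (hbi a haS hla hab)
          (ht.2 b (Finset.mem_sdiff.2 ⟨hbS, hbL⟩) (Ne.symm hab))
      refine ⟨l, ⟨hl.1, ((hlb a haS).2 hab).symm, hl.2 a haS hla⟩, ?_⟩
      rintro d ⟨hdS, had, hd⟩
      have hdL : d ∈ L := by
        by_contra hdL
        exact P.prefers_asymm hd (ht.2 d (Finset.mem_sdiff.2 ⟨hdS, hdL⟩) had.ne.symm)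
      by_contra hdl
      exact P.prefers_asymm (hl.2 a haS hla) (hmem d hdL had hd l hl.1 (Ne.symm hdl) hla.symm)
    · obtain ⟨b, ⟨hbS, hab, hb⟩, hbu⟩ := h i a haSL ht
      refine ⟨b, ⟨(Finset.mem_sdiff.1 hbS).1, hab, hb⟩, ?_⟩
      rintro d ⟨hdS, had, hd⟩
      refine hbu d ⟨Finset.mem_sdiff.2 ⟨hdS, fun hdL => ht ⟨haSL, fun c hc hca => ?_⟩⟩, had, hd⟩
      obtain ⟨hcS, hcL⟩ := Finset.mem_sdiff.1 hc
      exact hmem d hdL had hd c hcS (by rintro rfl; exact hcL hdL) hca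

variable (P)

open Classical in
/-- A generalization of `AttachmentRun` in which every step may remove any set of candidates that
are ranked last by some voter. -/
inductive PeelRun : Finset C → Digraph C → Prop
  | single (S : Finset C) : S.card ≤ 1 → PeelRun S ⟨fun _ _ => False⟩
  | pair (a b : C) : a ≠ b → PeelRun {a, b} ⟨fun x y => x = a ∧ y = b⟩
  | step (S L : Finset C) (D : Digraph C) : L ⊆ P.bottoms S →
      (∀ a ∈ L, (P.attachSet S a).Nonempty) →
      (∀ a ∈ L, Disjoint (P.attachSet S a) L) →
      PeelRun (S \ L) D →
      PeelRun S ⟨fun x y => (x ∈ L ∧ y ∈ P.attachSet S x) ∨ D.Adj x y⟩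

variable {P}

/-- A voter who ranks `b` last does not prefer it to `a`, so membership in the attachment set would
require `b` to beat a third candidate. With two candidates this fails, which is why the final pair
is a separate case of `AttachmentRun`. -/
theorem disjoint_attachSet_bottoms [Nonempty N] {S : Finset C} (hS : 3 ≤ S.card) {a : C}
    (ha : a ∈ S) : Disjoint (P.attachSet S a) (P.bottoms S) := by
  classical
  rw [Finset.disjoint_left]
  intro b hb hbot
  obtain ⟨hbS, i, hi⟩ := Finset.mem_filter.1 hbot
  obtain ⟨-, hba, h⟩ := (mem_attachSet ha).1 hb
  have : (({a, b} : Finset C)).card < S.card := lt_of_le_of_lt Finset.card_le_two hS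
  obtain ⟨c, hc, hcab⟩ := Finset.exists_mem_notMem_of_card_lt_card this
  simp only [Finset.mem_insert, Finset.mem_singleton, not_or] at hcab
  rcases h i with h | h
  · exact P.prefers_asymm h (hi.2 a ha hba.symm)
  · exact P.prefers_asymm (h c hc hcab.1 hcab.2) (hi.2 c hc hcab.2)

theorem AttachmentRun.peelRun [Nonempty N] {S : Finset C} {D : Digraph C}
    (h : P.AttachmentRun S D) : P.PeelRun S D := by
  induction h with
  | single S hS => exact .single S hS
  | pair a b hab => exact .pair a b hab
  | step S D hS hne _ ih =>
    have hd : ∀ a ∈ P.bottoms S, Disjoint (P.attachSet S a) (P.bottoms S) := fun a ha =>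
      disjoint_attachSet_bottoms hS (P.bottoms_subset S ha)
    exact .step S (P.bottoms S) D subset_rfl hne hd (by convert ih)

-- Attachment sets avoid the layer that is being removed, so every arc ends at a candidate that
-- survives its tail.
omit [Fintype C] in
theorem PeelRun.arc {S : Finset C} {D : Digraph C} (h : P.PeelRun S D) {a b : C}
    (hab : D.Adj a b) : a ∈ S ∧ b ∈ S ∧ ¬ D.Adj b a := by
  classical
  induction h generalizing a b with
  | single S hS => exact hab.elim
  | pair c d hcd =>
    obtain ⟨rfl, rfl⟩ := hab
    simp only [Finset.mem_insert, Finset.mem_singleton, true_or, or_true, true_and, not_and]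
    exact fun h => absurd h.symm hcd
  | step S L D hL hne hd _ ih =>
    rcases hab with ⟨haL, hb⟩ | hab
    · have hbL := Finset.disjoint_left.1 (hd a haL) hb
      refine ⟨P.bottoms_subset S (hL haL), P.attachSet_subset S a hb, ?_⟩
      rintro (⟨hbL', -⟩ | hba)
      · exact hbL hbL'
      · exact (Finset.mem_sdiff.1 (ih hba).2.1).2 haL
    · obtain ⟨haS, hbS, hba⟩ := ih hab
      obtain ⟨haS, haL⟩ := Finset.mem_sdiff.1 haS
      obtain ⟨hbS, hbL⟩ := Finset.mem_sdiff.1 hbS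
      exact ⟨haS, hbS, fun h => h.elim (fun h => hbL h.1) hba⟩

omit [Fintype C] in
theorem PeelRun.exists_sink {S : Finset C} {D : Digraph C} (h : P.PeelRun S D)
    (hS : S.Nonempty) : ∃ t ∈ S, IsSink D t ∧ ∀ a ∈ S, a ≠ t → ∃ b, D.Adj a b := by
  classical
  induction h with
  | single S hS' =>
    obtain ⟨t, ht⟩ := hS
    exact ⟨t, ht, fun _ h => h, fun a ha hat => absurd (Finset.card_le_one.1 hS' a ha t ht) hat⟩
  | pair c d hcd =>
    refine ⟨d, by simp, fun b hb => hcd hb.1.symm, fun a ha had => ⟨d, ?_, rfl⟩⟩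
    simpa [had] using ha
  | step S L D hL hne hd hrun ih =>
    -- A removed candidate has a nonempty attachment set, whose members survive.
    have hSL : (S \ L).Nonempty := by
      obtain ⟨s, hs⟩ := hS
      by_cases hsL : s ∈ L
      · obtain ⟨b, hb⟩ := hne s hsL
        exact ⟨b, Finset.mem_sdiff.2
          ⟨P.attachSet_subset S s hb, Finset.disjoint_left.1 (hd s hsL) hb⟩⟩
      · exact ⟨s, Finset.mem_sdiff.2 ⟨hs, hsL⟩⟩
    obtain ⟨t, ht, hsink, harc⟩ := ih hSL
    obtain ⟨htS, htL⟩ := Finset.mem_sdiff.1 ht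
    refine ⟨t, htS, fun b hb => hb.elim (fun h => htL h.1) (hsink b), fun a ha hat => ?_⟩
    by_cases haL : a ∈ L
    · obtain ⟨b, hb⟩ := hne a haL
      exact ⟨b, .inl ⟨haL, hb⟩⟩
    · obtain ⟨b, hb⟩ := harc a (Finset.mem_sdiff.2 ⟨ha, haL⟩) hat
      exact ⟨b, .inr hb⟩

/-- Within `S`, the edges of `T` consist of one outgoing arc of `D` for every vertex that has one. -/
def _root_.SinglePeakedTree.IsAttached (S : Finset C) (D : Digraph C) (T : SimpleGraph C) : Prop :=
  (∀ a ∈ S, ∀ b ∈ S, T.Adj a b → D.Adj a b ∨ D.Adj b a) ∧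
    ∀ a ∈ S, (∃ b, D.Adj a b) → ∃! b, T.Adj a b ∧ D.Adj a b

theorem hasUniqueBetterNeighbor_pair [Nonempty N] {a b : C} (hab : a ≠ b) [DecidableEq C]
    {T : SimpleGraph C} : P.HasUniqueBetterNeighbor {a, b} T ↔ T.Adj a b := by
  constructor
  · intro h
    obtain ⟨i⟩ := ‹Nonempty N›
    have key : ∀ c d, c ∈ ({a, b} : Finset C) → d ∈ ({a, b} : Finset C) → P.prefers i c d →
        T.Adj a b := by
      intro c d hc hd hcd
      obtain ⟨e, ⟨heS, hde, -⟩, -⟩ := h i d hd ((not_isTop_iff hd).2 ⟨c, hc, hcd⟩)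
      simp only [Finset.mem_insert, Finset.mem_singleton] at hd heS
      rcases hd with rfl | rfl <;> rcases heS with rfl | rfl
      · exact (T.irrefl hde).elim
      · exact hde
      · exact hde.symm
      · exact (T.irrefl hde).elim
    rcases P.prefers_or_prefers i hab with h' | h'
    · exact key a b (by simp) (by simp) h'
    · exact key b a (by simp) (by simp) h'
  · intro h i c hc hnt
    obtain ⟨d, hd, hdc⟩ := (not_isTop_iff hc).1 hnt
    have hcd := P.prefers_ne hdc
    refine ⟨d, ⟨hd, ?_, hdc⟩, ?_⟩
    · simp only [Finset.mem_insert, Finset.mem_singleton] at hc hd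
      rcases hc with rfl | rfl <;> rcases hd with rfl | rfl <;>
        first | exact absurd rfl hcd | exact h | exact h.symm
    · rintro e ⟨he, hce, -⟩
      have := hce.ne
      simp only [Finset.mem_insert, Finset.mem_singleton] at hc hd he
      grind

/-- Every peeling step splits the condition on `S` into the condition on `S \ L` and the requirement
that each member of `L` be a leaf attached within its attachment set. On the digraph side this is
the choice of one outgoing arc per removed candidate. -/
theorem PeelRun.hasUniqueBetterNeighbor_iff [Nonempty N] {S : Finset C} {D : Digraph C}
    (h : P.PeelRun S D) (T : SimpleGraph C) :
    P.HasUniqueBetterNeighbor S T ↔ IsAttached S D T := by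
  classical
  induction h with
  | single S hS =>
    rw [Finset.card_le_one] at hS
    refine iff_of_true (fun i a ha hnt => ?_) ⟨fun a ha b hb hab => ?_, fun a ha h => ?_⟩
    · obtain ⟨b, hb, hba⟩ := (not_isTop_iff ha).1 hnt
      exact absurd (hS b hb a ha) (P.prefers_ne hba)
    · exact absurd (hS a ha b hb) hab.ne
    · exact h.choose_spec.elim
  | pair a b hab =>
    have := hasUniqueBetterNeighbor_pair (P := P) hab (T := T)
    refine this.trans ⟨fun h => ⟨?_, ?_⟩, fun h => ?_⟩
    · intro c hc d hd hcd
      have := hcd.ne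
      simp only [Finset.mem_insert, Finset.mem_singleton] at hc hd
      grind
    · rintro c - ⟨d, rfl, rfl⟩
      exact ⟨d, ⟨h, rfl, rfl⟩, fun y hy => hy.2.2⟩
    · obtain ⟨c, ⟨hc, -, rfl⟩, -⟩ := h.2 a (by simp) ⟨b, rfl, rfl⟩
      exact hc
  | step S L D hL hne hd hrun ih =>
    have hLS := hL.trans (P.bottoms_subset S)
    have h1 : P.HasUniqueBetterNeighbor S T ↔ P.HasUniqueBetterNeighbor (S \ L) T ∧
        ∀ a ∈ L, ∃ b ∈ P.attachSet S a, ∀ d ∈ S, T.Adj a d ↔ d = b := by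
      refine ⟨fun h => ⟨h.sdiff hL, fun a ha => ?_⟩, fun h => h.1.of_sdiff hLS hd h.2⟩
      obtain ⟨b, hb⟩ := hne a ha
      obtain ⟨hbS, hba, -⟩ := (mem_attachSet (hLS ha)).1 hb
      exact h.exists_leaf (hL ha) hbS hba
    rw [h1, ih]
    have harc : ∀ a b, D.Adj a b → a ∈ S ∧ a ∉ L ∧ b ∈ S ∧ b ∉ L := by
      intro a b hab
      obtain ⟨h1, h2, -⟩ := hrun.arc hab
      exact ⟨(Finset.mem_sdiff.1 h1).1, (Finset.mem_sdiff.1 h1).2,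
        (Finset.mem_sdiff.1 h2).1, (Finset.mem_sdiff.1 h2).2⟩
    constructor
    · rintro ⟨⟨he, hu⟩, hleaf⟩
      have hout : ∀ a ∈ L, ∀ b ∈ S, T.Adj a b → b ∈ P.attachSet S a := by
        intro a haL b hb hab
        obtain ⟨c, hc, hac⟩ := hleaf a haL
        rwa [(hac b hb).1 hab]
      refine ⟨fun a ha b hb hab => ?_, fun a ha hex => ?_⟩
      · by_cases haL : a ∈ L
        · exact .inl (.inl ⟨haL, hout a haL b hb hab⟩)
        by_cases hbL : b ∈ L
        · exact .inr (.inl ⟨hbL, hout b hbL a ha hab.symm⟩)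
        exact (he a (Finset.mem_sdiff.2 ⟨ha, haL⟩) b (Finset.mem_sdiff.2 ⟨hb, hbL⟩) hab).imp
          .inr .inr
      · by_cases haL : a ∈ L
        · obtain ⟨c, hc, hac⟩ := hleaf a haL
          refine ⟨c, ⟨(hac c (P.attachSet_subset S a hc)).2 rfl, .inl ⟨haL, hc⟩⟩, ?_⟩
          rintro y ⟨hay, ⟨-, hy⟩ | hy⟩
          · exact (hac y (P.attachSet_subset S a hy)).1 hay
          · exact absurd haL (harc a y hy).2.1
        · obtain ⟨b, ⟨h', -⟩ | hb⟩ := hex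
          · exact absurd h' haL
          obtain ⟨c, ⟨hac, hc⟩, hcu⟩ := hu a (Finset.mem_sdiff.2 ⟨ha, haL⟩) ⟨b, hb⟩
          refine ⟨c, ⟨hac, .inr hc⟩, ?_⟩
          rintro y ⟨hay, ⟨h', -⟩ | hy⟩
          · exact absurd h' haL
          · exact hcu y ⟨hay, hy⟩
    · rintro ⟨he, hu⟩
      refine ⟨⟨fun a ha b hb hab => ?_, fun a ha ⟨b, hb⟩ => ?_⟩, fun a haL => ?_⟩
      · obtain ⟨ha, haL⟩ := Finset.mem_sdiff.1 ha
        obtain ⟨hb, hbL⟩ := Finset.mem_sdiff.1 hb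
        exact (he a ha b hb hab).imp (fun h => h.resolve_left fun h => haL h.1)
          (fun h => h.resolve_left fun h => hbL h.1)
      · obtain ⟨ha, haL⟩ := Finset.mem_sdiff.1 ha
        obtain ⟨c, ⟨hac, hc⟩, hcu⟩ := hu a ha ⟨b, .inr hb⟩
        exact ⟨c, ⟨hac, hc.resolve_left fun h => haL h.1⟩, fun y hy => hcu y ⟨hy.1, .inr hy.2⟩⟩
      · obtain ⟨b, hb⟩ := hne a haL
        obtain ⟨c, ⟨hac, hc⟩, hcu⟩ := hu a (hLS haL) ⟨b, .inl ⟨haL, hb⟩⟩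
        have hc := hc.resolve_right fun h => (harc a c h).2.1 haL
        refine ⟨c, hc.2, fun d hdS => ⟨fun had => ?_, fun h => h ▸ hac⟩⟩
        refine hcu d ⟨had, (he a (hLS haL) d hdS had).resolve_right ?_⟩
        rintro (⟨hdL, h'⟩ | h')
        · exact Finset.disjoint_left.1 (hd d hdL) h' haL
        · exact (harc d a h').2.2.2 haL

/-- The neighbour of each last-ranked candidate witnesses that its attachment set is nonempty, and
the condition is inherited by the remaining candidates, so the construction never fails; a voter
guarantees that every layer is nonempty. -/
theorem HasUniqueBetterNeighbor.exists_attachmentRun [Nonempty N] {T : SimpleGraph C}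
    (S : Finset C) (h : P.HasUniqueBetterNeighbor S T) : ∃ D, P.AttachmentRun S D := by
  classical
  induction S using Finset.strongInduction with
  | H S ih =>
    rcases lt_or_ge S.card 2 with hS | hS
    · exact ⟨_, .single S (by omega)⟩
    rcases hS.eq_or_lt with hS | hS
    · obtain ⟨a, b, hab, rfl⟩ := Finset.card_eq_two.1 hS.symm
      exact ⟨_, by convert AttachmentRun.pair a b hab⟩
    · have hne : ∀ a ∈ P.bottoms S, (P.attachSet S a).Nonempty := by
        intro a ha
        obtain ⟨c, hc, hca⟩ := Finset.exists_mem_ne (by omega : 1 < S.card) a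
        obtain ⟨b, hb, -⟩ := h.exists_leaf ha hc hca
        exact ⟨b, hb⟩
      have hlt : S \ P.bottoms S ⊂ S := by
        obtain ⟨i⟩ := ‹Nonempty N›
        obtain ⟨a, ha⟩ := P.exists_isBottom i (S := S) (Finset.card_pos.1 (by omega))
        refine Finset.sdiff_ssubset (P.bottoms_subset S) ⟨a, ?_⟩
        exact Finset.mem_filter.2 ⟨ha.1, i, ha⟩
      obtain ⟨D, hD⟩ := ih _ hlt (by convert h.sdiff subset_rfl)
      exact ⟨_, .step S D hS hne (by convert hD)⟩

end Profile

end

/-! ### Attachment functions and the degrees of their trees -/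

section

/-- Every tree on which `P` is single-peaked consists of one outgoing arc of `D` for every vertex
other than the sink `t`. -/
structure OrientsTrees {N C : Type*} [Fintype C] (P : Profile N C) (D : Digraph C) (t : C) :
    Prop where
  isSink : IsSink D t
  asymm : ∀ {a b}, D.Adj a b → ¬ D.Adj b a
  exists_arc : ∀ {a}, a ≠ t → ∃ b, D.Adj a b
  mem_trees : ∀ T, T ∈ P.trees ↔ IsAttached Finset.univ D T

theorem Profile.PeelRun.exists_orientsTrees {N C : Type*} [Fintype C] [Nonempty N] [Nonempty C]
    {P : Profile N C} {D : Digraph C} (h : P.PeelRun Finset.univ D) : ∃ t, OrientsTrees P D t := by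
  obtain ⟨t, -, hsink, harc⟩ := h.exists_sink Finset.univ_nonempty
  exact ⟨t, hsink, fun hab => (h.arc hab).2.2, fun ha => harc _ (Finset.mem_univ _) ha,
    fun T => Profile.mem_trees_iff.trans (h.hasUniqueBetterNeighbor_iff T)⟩

/-- The bound on the number of candidates that may be attached to `b`. -/
def capacity {C : Type*} [DecidableEq C] (t : C) (k : ℕ) (b : C) : ℕ := if b = t then k else k - 1

section

variable {C : Type*} [Fintype C] [DecidableEq C] {D : Digraph C} {t : C}

/-- The number of candidates attached to `b`. -/
def load (f : {a : C // a ≠ t} → C) (b : C) : ℕ := (Finset.univ.filter fun a => f a = b).card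

omit [Fintype C] [DecidableEq C] in
theorem treeOf_adj (hD : ∀ {a b}, D.Adj a b → ¬ D.Adj b a) {f : {a : C // a ≠ t} → C}
    (hf : IsAttachmentFunction D t f) {a b : C} :
    (treeOf t f).Adj a b ↔ (∃ h : a ≠ t, f ⟨a, h⟩ = b) ∨ ∃ h : b ≠ t, f ⟨b, h⟩ = a := by
  rw [treeOf, SimpleGraph.fromRel_adj]
  refine ⟨fun h => h.2, fun h => ⟨?_, h⟩⟩
  rintro rfl
  have : ∃ h : a ≠ t, f ⟨a, h⟩ = a := by simpa using h
  obtain ⟨h, hfa⟩ := this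
  have := hf ⟨a, h⟩
  rw [hfa] at this
  exact hD this this

-- An edge `{a, f a}` can arise in the other graph only from `a` or from `f a`; the latter would
-- give an arc opposite to `(a, f a)`.
omit [Fintype C] [DecidableEq C] in
theorem treeOf_injective (hD : ∀ {a b}, D.Adj a b → ¬ D.Adj b a) {f f' : {a : C // a ≠ t} → C}
    (hf : IsAttachmentFunction D t f) (hf' : IsAttachmentFunction D t f')
    (h : treeOf t f = treeOf t f') : f = f' := by
  funext ⟨a, ha⟩
  have hadj : (treeOf t f').Adj a (f ⟨a, ha⟩) := by
    rw [← h, treeOf_adj hD hf]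
    exact .inl ⟨ha, rfl⟩
  rw [treeOf_adj hD hf'] at hadj
  rcases hadj with ⟨h₁, h'⟩ | ⟨hb, h'⟩
  · exact h'.symm
  · have h1 := hf' ⟨_, hb⟩
    rw [h'] at h1
    exact absurd h1 (hD (hf ⟨a, ha⟩))

omit [DecidableEq C] in
theorem isAttached_iff (hD : ∀ {a b}, D.Adj a b → ¬ D.Adj b a) (ht : IsSink D t)
    (harc : ∀ {a}, a ≠ t → ∃ b, D.Adj a b) {T : SimpleGraph C} :
    IsAttached Finset.univ D T ↔ ∃ f, IsAttachmentFunction D t f ∧ T = treeOf t f := by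
  constructor
  · rintro ⟨he, hu⟩
    choose f hf hfu using fun a : {a : C // a ≠ t} => hu a.1 (Finset.mem_univ _) (harc a.2)
    have hatt : IsAttachmentFunction D t f := fun a => (hf a).2
    have key : ∀ {a b}, T.Adj a b → D.Adj a b → ∃ h : a ≠ t, f ⟨a, h⟩ = b := by
      intro a b hab hD
      have hat : a ≠ t := by rintro rfl; exact ht b hD
      exact ⟨hat, (hfu ⟨a, hat⟩ b ⟨hab, hD⟩).symm⟩
    refine ⟨f, hatt, ?_⟩
    ext a b
    rw [treeOf_adj hD hatt]
    constructor
    · intro hab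
      exact (he a (Finset.mem_univ _) b (Finset.mem_univ _) hab).imp (key hab) (key hab.symm)
    · rintro (⟨h, rfl⟩ | ⟨h, rfl⟩)
      · exact (hf ⟨a, h⟩).1
      · exact (hf ⟨b, h⟩).1.symm
  · rintro ⟨f, hf, rfl⟩
    refine ⟨fun a _ b _ hab => ?_, fun a _ ⟨c, hac⟩ => ?_⟩
    · rcases (treeOf_adj hD hf).1 hab with ⟨h, rfl⟩ | ⟨h, rfl⟩
      · exact .inl (hf ⟨a, h⟩)
      · exact .inr (hf ⟨b, h⟩)
    · have hat : a ≠ t := by rintro rfl; exact ht c hac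
      refine ⟨f ⟨a, hat⟩, ⟨(treeOf_adj hD hf).2 (.inl ⟨hat, rfl⟩), hf ⟨a, hat⟩⟩, ?_⟩
      rintro b ⟨hab, hDab⟩
      rcases (treeOf_adj hD hf).1 hab with ⟨h, h'⟩ | ⟨h, rfl⟩
      · exact h'.symm
      · exact absurd (hf ⟨b, h⟩) (hD hDab)

/-- The neighbours of `b` are the candidates attached to it and, unless `b = t`, the candidate `f
b`. These are distinct because there are no opposite arcs. -/
theorem degree_treeOf (hD : ∀ {a b}, D.Adj a b → ¬ D.Adj b a) {f : {a : C // a ≠ t} → C}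
    (hf : IsAttachmentFunction D t f) [DecidableRel (treeOf t f).Adj] (b : C) :
    (treeOf t f).degree b = load f b + if b = t then 0 else 1 := by
  have hN : (treeOf t f).neighborFinset b =
      (Finset.univ.filter fun a => f a = b).image Subtype.val ∪
        (if h : b = t then ∅ else {f ⟨b, h⟩}) := by
    ext a
    rw [SimpleGraph.mem_neighborFinset, treeOf_adj hD hf, Finset.mem_union, or_comm]
    refine or_congr (by simp) ?_
    split_ifs with h
    · simp [h]
    · simp [h, eq_comm]
  have hdisj : Disjoint ((Finset.univ.filter fun a => f a = b).image Subtype.val)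
      (if h : b = t then ∅ else {f ⟨b, h⟩}) := by
    split_ifs with h
    · simp
    · rw [Finset.disjoint_singleton_right, Finset.mem_image]
      rintro ⟨a, ha, hab⟩
      have h1 := hf a
      rw [(Finset.mem_filter.1 ha).2, hab] at h1
      exact hD h1 (hf ⟨b, h⟩)
  rw [← SimpleGraph.card_neighborFinset_eq_degree, hN, Finset.card_union_of_disjoint hdisj,
    Finset.card_image_of_injective _ Subtype.val_injective, load]
  congr 1
  split_ifs <;> simp

theorem maxDegree_treeOf_le (hD : ∀ {a b}, D.Adj a b → ¬ D.Adj b a) {f : {a : C // a ≠ t} → C}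
    (hf : IsAttachmentFunction D t f) [DecidableRel (treeOf t f).Adj] {k : ℕ} (hk : 1 ≤ k) :
    (treeOf t f).maxDegree ≤ k ↔ ∀ b, load f b ≤ capacity t k b := by
  have h1 : (treeOf t f).maxDegree ≤ k ↔ ∀ b, (treeOf t f).degree b ≤ k :=
    ⟨fun h b => ((treeOf t f).degree_le_maxDegree b).trans h,
      (treeOf t f).maxDegree_le_of_forall_degree_le k⟩
  rw [h1]
  refine forall_congr' fun b => ?_
  rw [degree_treeOf hD hf, capacity]
  split_ifs <;> omega

end

theorem OrientsTrees.mem_treesMaxDegree {N C : Type*} [Fintype C] [DecidableEq C]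
    {P : Profile N C} {D : Digraph C} {t : C} (h : OrientsTrees P D t) {k : ℕ} (hk : 1 ≤ k)
    {T : SimpleGraph C} :
    T ∈ P.treesMaxDegree k ↔
      ∃ f, IsAttachmentFunction D t f ∧ (∀ b, load f b ≤ capacity t k b) ∧ T = treeOf t f := by
  classical
  rw [Profile.treesMaxDegree, Set.mem_ofPred_eq, h.mem_trees,
    isAttached_iff h.asymm h.isSink h.exists_arc]
  constructor
  · rintro ⟨⟨f, hf, rfl⟩, hd⟩
    refine ⟨f, hf, ?_, rfl⟩
    rw [← maxDegree_treeOf_le h.asymm hf hk]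
    convert hd
  · rintro ⟨f, hf, hl, rfl⟩
    refine ⟨⟨f, hf, rfl⟩, ?_⟩
    rw [← maxDegree_treeOf_le h.asymm hf hk] at hl
    convert hl

/-! ### Integral flows -/

section

variable {C : Type*} [Fintype C] {D : Digraph C} {t : C}

open Classical in
theorem sum_netVertex {M : Type*} [AddCommMonoid M] (F : NetVertex C t → M) :
    ∑ v, F v = F .x + F .z + (∑ a, F (.l a) + ∑ b, F (.r b)) := by
  rw [Fintype.sum_equiv (NetVertex.equiv C t) F
    (fun v => F ((NetVertex.equiv C t).symm v)) (by simp)]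
  simp [Fintype.sum_sum_type, NetVertex.equiv]

open Classical in
/-- The flow that sends one unit along `x → ℓ_a → r_(f a) → z` for every `a`. -/
noncomputable def flowOf (f : {a : C // a ≠ t} → C) : NetVertex C t → NetVertex C t → ℕ
  | .x, .l _ => 1
  | .l a, .r b => if f a = b then 1 else 0
  | .r b, .z => load f b
  | _, _ => 0

open Classical in
theorem isFlow_flowOf {f : {a : C // a ≠ t} → C} (hf : IsAttachmentFunction D t f) {k : ℕ}
    (hl : ∀ b, load f b ≤ capacity t k b) : (degreeNetwork D t k).IsFlow (flowOf f) where
  eq_zero u v huv := by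
    rcases u with _ | _ | a | b <;> rcases v with _ | _ | c | d <;>
      simp [degreeNetwork, flowOf] at huv ⊢
    rintro rfl
    exact huv (hf a)
  le_cap u v huv := by
    rcases u with _ | _ | a | b <;> rcases v with _ | _ | c | d <;>
      simp [degreeNetwork, flowOf] at huv ⊢
    · split_ifs <;> simp
    · exact hl b
  conserved v hx hz := by
    rcases v with _ | _ | a | b
    · exact absurd rfl hx
    · exact absurd rfl hz
    · simp [sum_netVertex, flowOf]
    · simp [sum_netVertex, flowOf, load, Finset.sum_boole]

open Classical in
theorem value_eq {k : ℕ} {g : NetVertex C t → NetVertex C t → ℕ}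
    (hg : (degreeNetwork D t k).IsFlow g) :
    (degreeNetwork D t k).value g = ∑ a, (g .x (.l a) : ℤ) := by
  classical
  have h1 : ∀ v, g v .x = 0 := fun v => hg.eq_zero _ _ (by cases v <;> simp [degreeNetwork])
  have h2 : g .x .z = 0 := hg.eq_zero _ _ (by simp [degreeNetwork])
  have h3 : ∀ b, g .x (.r b) = 0 := fun b => hg.eq_zero _ _ (by simp [degreeNetwork])
  have hs : (degreeNetwork D t k).source = .x := rfl
  rw [FlowNetwork.value, hs]
  simp [sum_netVertex, h1, h2, h3]

theorem card_ne (t : C) [Fintype {a : C // a ≠ t}] :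
    (Fintype.card {a : C // a ≠ t} : ℤ) = Fintype.card C - 1 := by
  classical
  have h : 0 < Fintype.card C := Fintype.card_pos_iff.2 ⟨t⟩
  have := Fintype.card_subtype_compl (fun a => a = t)
  rw [Fintype.card_subtype_eq] at this
  have h2 : Fintype.card {a : C // a ≠ t} = Fintype.card {a : C // ¬ a = t} :=
    Fintype.card_congr (Equiv.refl _)
  omega

theorem value_le {k : ℕ} {g : NetVertex C t → NetVertex C t → ℕ}
    (hg : (degreeNetwork D t k).IsFlow g) :
    (degreeNetwork D t k).value g ≤ (Fintype.card C : ℤ) - 1 := by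
  classical
  rw [value_eq hg, ← card_ne t]
  have : ∀ a ∈ (Finset.univ : Finset {a : C // a ≠ t}), (g .x (.l a) : ℤ) ≤ 1 := fun a _ => by
    exact_mod_cast hg.le_cap .x (.l a) trivial
  simpa using Finset.sum_le_card_nsmul _ _ _ this

open Classical in
theorem flowOf_mem_fullFlows {f : {a : C // a ≠ t} → C} (hf : IsAttachmentFunction D t f) {k : ℕ}
    (hl : ∀ b, load f b ≤ capacity t k b) : flowOf f ∈ fullFlows D t k := by
  refine ⟨isFlow_flowOf hf hl, ?_⟩
  rw [value_eq (isFlow_flowOf hf hl), ← card_ne t]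
  simp [flowOf]

-- The value is the sum over `|C| - 1` source arcs of capacity one, so all are saturated.
-- Conservation at `ℓ_a` then leaves one unit, which by integrality uses a single arc and defines `f
-- a`; conservation at `r_b` identifies the flow into the sink with the load, so the capacities
-- bound the loads.
open Classical in
theorem eq_flowOf {k : ℕ} {g : NetVertex C t → NetVertex C t → ℕ} (hg : g ∈ fullFlows D t k) :
    ∃ f, IsAttachmentFunction D t f ∧ (∀ b, load f b ≤ capacity t k b) ∧ g = flowOf f := by
  obtain ⟨hg, hv⟩ := hg
  have hx : ∀ v, g v .x = 0 := fun v => hg.eq_zero _ _ (by cases v <;> simp [degreeNetwork])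
  have hz : ∀ v, g .z v = 0 := fun v => hg.eq_zero _ _ (by cases v <;> simp [degreeNetwork])
  have hxz : g .x .z = 0 := hg.eq_zero _ _ (by simp [degreeNetwork])
  have hxr : ∀ b, g .x (.r b) = 0 := fun b => hg.eq_zero _ _ (by simp [degreeNetwork])
  have hll : ∀ a b, g (.l a) (.l b) = 0 := fun a b => hg.eq_zero _ _ (by simp [degreeNetwork])
  have hlz : ∀ a, g (.l a) .z = 0 := fun a => hg.eq_zero _ _ (by simp [degreeNetwork])
  have hrl : ∀ a b, g (.r a) (.l b) = 0 := fun a b => hg.eq_zero _ _ (by simp [degreeNetwork])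
  have hrr : ∀ a b, g (.r a) (.r b) = 0 := fun a b => hg.eq_zero _ _ (by simp [degreeNetwork])
  have hle : ∀ a, g .x (.l a) ≤ 1 := fun a => hg.le_cap .x (.l a) trivial
  have hxl : ∀ a, g .x (.l a) = 1 := by
    rw [value_eq hg, ← card_ne t] at hv
    have h1 : ∑ a : {a : C // a ≠ t}, g .x (.l a) = ∑ a : {a : C // a ≠ t}, 1 := by
      have : (∑ a : {a : C // a ≠ t}, g .x (.l a) : ℕ) = Fintype.card {a : C // a ≠ t} := by
        exact_mod_cast hv
      simpa using this
    exact fun a => (Finset.sum_eq_sum_iff_of_le fun a _ => hle a).1 h1 a (Finset.mem_univ a)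
  have hl1 : ∀ a, ∑ b, g (.l a) (.r b) = 1 := by
    intro a
    have := hg.conserved (.l a) (by simp [degreeNetwork]) (by simp [degreeNetwork])
    simpa [sum_netVertex, hx, hz, hxl, hll, hrl, hlz, eq_comm] using this
  have hr1 : ∀ b, ∑ a, g (.l a) (.r b) = g (.r b) .z := by
    intro b
    have := hg.conserved (.r b) (by simp [degreeNetwork]) (by simp [degreeNetwork])
    simpa [sum_netVertex, hx, hz, hxr, hrl, hrr] using this
  have hex : ∀ a, ∃ b, ∀ c, g (.l a) (.r c) = if b = c then 1 else 0 := by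
    intro a
    obtain ⟨b, -, hb⟩ := Finset.exists_ne_zero_of_sum_ne_zero (by rw [hl1 a]; exact one_ne_zero)
    have h2 := hl1 a
    rw [← Finset.add_sum_erase _ _ (Finset.mem_univ b)] at h2
    have h3 : ∑ c ∈ Finset.univ.erase b, g (.l a) (.r c) = 0 := by omega
    refine ⟨b, fun c => ?_⟩
    split_ifs with hbc
    · subst hbc; omega
    · exact Finset.sum_eq_zero_iff.1 h3 c (Finset.mem_erase.2 ⟨Ne.symm hbc, Finset.mem_univ c⟩)
  choose f hf using hex
  have hload : ∀ b, g (.r b) .z = load f b := by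
    intro b
    rw [← hr1 b, load, Finset.card_filter]
    exact Finset.sum_congr rfl fun a _ => hf a b
  refine ⟨f, fun a => ?_, fun b => ?_, ?_⟩
  · by_contra hD
    have h1 := hg.eq_zero (.l a) (.r (f a)) hD
    simp [hf] at h1
  · rw [← hload b]
    exact hg.le_cap (.r b) .z trivial
  · funext u v
    rcases u with _ | _ | a | b <;> rcases v with _ | _ | c | d <;>
      simp [flowOf, hx, hz, hxz, hxr, hxl, hll, hlz, hrl, hrr, hf, hload]

theorem readOff_flowOf {f : {a : C // a ≠ t} → C} (hf : IsAttachmentFunction D t f) (k : ℕ) :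
    ReadOff D t k (flowOf f) f := by
  classical
  refine ⟨hf, fun a b => ?_⟩
  simp only [flowOf, degreeNetwork]
  refine ⟨fun h => ⟨h ▸ hf a, if_pos h⟩, fun h => ?_⟩
  by_contra hab
  simp [hab] at h

omit [Fintype C] in
theorem ReadOff.eq {f f' : {a : C // a ≠ t} → C} {k : ℕ} {g : NetVertex C t → NetVertex C t → ℕ}
    (h : ReadOff D t k g f) (h' : ReadOff D t k g f') : f = f' := by
  funext a
  exact ((h'.2 a (f a)).2 ((h.2 a (f a)).1 rfl)).symm

theorem exists_isMaximumFlow (D : Digraph C) (t : C) (k : ℕ) :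
    ∃ g, (degreeNetwork D t k).IsMaximumFlow g := by
  have h0 : (degreeNetwork D t k).IsFlow fun _ _ => 0 := ⟨by simp, by simp, by simp⟩
  obtain ⟨v, ⟨g, hg, rfl⟩, hmax⟩ := Int.exists_greatest_of_bdd
    (P := fun v => ∃ g, (degreeNetwork D t k).IsFlow g ∧ (degreeNetwork D t k).value g = v)
    ⟨(Fintype.card C : ℤ) - 1, fun v ⟨g, hg, hv⟩ => hv ▸ value_le hg⟩ ⟨_, _, h0, rfl⟩
  exact ⟨g, hg, fun g' hg' => hmax _ ⟨g', hg', rfl⟩⟩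

theorem isMaximumFlow_of_mem_fullFlows {k : ℕ} {g : NetVertex C t → NetVertex C t → ℕ}
    (hg : g ∈ fullFlows D t k) : (degreeNetwork D t k).IsMaximumFlow g :=
  ⟨hg.1, fun _ hg' => (value_le hg').trans hg.2.ge⟩

end

variable {N C : Type*} [Fintype C] {P : Profile N C}

theorem OrientsTrees.exists_equiv {D : Digraph C} {t : C} (h : OrientsTrees P D t) {k : ℕ}
    (hk : 1 ≤ k) : ∃ e : fullFlows D t k ≃ P.treesMaxDegree k,
      ∀ g : fullFlows D t k, ∃ f, ReadOff D t k g.1 f ∧ (e g).1 = treeOf t f := by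
  classical
  choose f hf hl hgf using fun g : fullFlows D t k => eq_flowOf g.2
  let φ : fullFlows D t k → P.treesMaxDegree k := fun g =>
    ⟨treeOf t (f g), (h.mem_treesMaxDegree hk).2 ⟨f g, hf g, hl g, rfl⟩⟩
  have hφ : Function.Bijective φ := by
    constructor
    · intro g g' hgg
      have := treeOf_injective h.asymm (hf g) (hf g') (congrArg Subtype.val hgg)
      exact Subtype.ext (by rw [hgf g, hgf g', this])
    · rintro ⟨T, hT⟩
      obtain ⟨f', hf', hl', rfl⟩ := (h.mem_treesMaxDegree hk).1 hT
      refine ⟨⟨flowOf f', flowOf_mem_fullFlows hf' hl'⟩, Subtype.ext ?_⟩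
      have h1 := readOff_flowOf (hf ⟨flowOf f', flowOf_mem_fullFlows hf' hl'⟩) k
      rw [← hgf] at h1
      exact congrArg (treeOf t) (h1.eq (readOff_flowOf hf' k))
  refine ⟨Equiv.ofBijective φ hφ, fun g => ⟨f g, ?_, rfl⟩⟩
  have h1 := readOff_flowOf (hf g) k
  rwa [← hgf] at h1

theorem OrientsTrees.trees_nonempty {D : Digraph C} {t : C} (h : OrientsTrees P D t) :
    P.trees.Nonempty := by
  choose f hf using fun a : {a : C // a ≠ t} => h.exists_arc a.2
  exact ⟨treeOf t f, (h.mem_trees _).2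
    ((isAttached_iff h.asymm h.isSink h.exists_arc).2 ⟨f, hf, rfl⟩)⟩

variable [Nonempty N] [Nonempty C]

theorem Profile.IsAttachmentDigraph.existsUnique_sink {D : Digraph C}
    (h : P.IsAttachmentDigraph D) : ∃! t, IsSink D t := by
  obtain ⟨t, ht⟩ := h.peelRun.exists_orientsTrees
  refine ⟨t, ht.isSink, fun s hs => ?_⟩
  by_contra hst
  obtain ⟨b, hb⟩ := ht.exists_arc hst
  exact hs b hb

theorem Profile.IsAttachmentDigraph.orientsTrees {D : Digraph C}
    (h : P.IsAttachmentDigraph D) {t : C} (ht : IsSink D t) : OrientsTrees P D t := by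
  obtain ⟨s, hs⟩ := h.peelRun.exists_orientsTrees
  rwa [h.existsUnique_sink.unique ht hs.isSink]

variable (P) in
theorem exists_isAttachmentDigraph_iff :
    (∃ D, P.IsAttachmentDigraph D) ↔ P.trees.Nonempty := by
  constructor
  · rintro ⟨D, hD⟩
    obtain ⟨t, ht, -⟩ := hD.existsUnique_sink
    exact (hD.orientsTrees ht).trees_nonempty
  · rintro ⟨T, hT⟩
    exact (Profile.mem_trees_iff.1 hT).exists_attachmentRun

theorem DegreeAlgorithmReturns.mem_treesMaxDegree {k : ℕ} (hk : 1 ≤ k) {T : SimpleGraph C}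
    (h : DegreeAlgorithmReturns P k (some T)) : T ∈ P.treesMaxDegree k := by
  classical
  obtain _ | ⟨D, t, g, f, hD, ht, hmax, hv, hf⟩ | _ := h
  obtain ⟨f', hf', hl', rfl⟩ := eq_flowOf (show g ∈ fullFlows D t k from ⟨hmax.1, hv⟩)
  rw [(hD.orientsTrees ht).mem_treesMaxDegree hk]
  exact ⟨f', hf', hl', congrArg _ (hf.eq (readOff_flowOf hf' k))⟩

/-- The flow of an attachment function within the capacities has the largest conceivable value, so
the algorithm may happen to compute it. A program may thus present any suitable tree, however it was
found. -/
theorem degreeAlgorithmReturns_some {k : ℕ} (hk : 1 ≤ k) {T : SimpleGraph C}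
    (hT : T ∈ P.treesMaxDegree k) : DegreeAlgorithmReturns P k (some T) := by
  classical
  obtain ⟨D, hD⟩ := (exists_isAttachmentDigraph_iff P).2 ⟨T, hT.1⟩
  obtain ⟨t, ht, -⟩ := hD.existsUnique_sink
  obtain ⟨f, hf, hl, rfl⟩ := ((hD.orientsTrees ht).mem_treesMaxDegree hk).1 hT
  have hg := flowOf_mem_fullFlows hf hl
  exact .tree D t _ f hD ht (isMaximumFlow_of_mem_fullFlows hg) hg.2 (readOff_flowOf hf k)

theorem DegreeAlgorithmReturns.treesMaxDegree_eq_empty {k : ℕ} (hk : 1 ≤ k)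
    (h : DegreeAlgorithmReturns P k none) : ¬ (P.treesMaxDegree k).Nonempty := by
  classical
  rintro ⟨T, hT⟩
  obtain hD | _ | ⟨D, t, g, hD, ht, hmax, hv⟩ := h
  · exact hD ((exists_isAttachmentDigraph_iff P).2 ⟨T, hT.1⟩)
  · obtain ⟨f, hf, hl, rfl⟩ := ((hD.orientsTrees ht).mem_treesMaxDegree hk).1 hT
    have hg := flowOf_mem_fullFlows hf hl
    exact hv (le_antisymm (value_le hmax.1) (hg.2 ▸ hmax.2 _ hg.1))

theorem degreeAlgorithmReturns_none {k : ℕ} (hk : 1 ≤ k)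
    (h : ¬ (P.treesMaxDegree k).Nonempty) : DegreeAlgorithmReturns P k none := by
  classical
  by_cases hD : ∃ D, P.IsAttachmentDigraph D
  · obtain ⟨D, hD⟩ := hD
    obtain ⟨t, ht, -⟩ := hD.existsUnique_sink
    obtain ⟨g, hg⟩ := exists_isMaximumFlow D t k
    refine .noTree D t g hD ht hg fun hv => h ?_
    obtain ⟨f, hf, hl, rfl⟩ := eq_flowOf (show g ∈ fullFlows D t k from ⟨hg.1, hv⟩)
    exact ⟨_, ((hD.orientsTrees ht).mem_treesMaxDegree hk).2 ⟨f, hf, hl, rfl⟩⟩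
  · exact .fail hD

end

/-! ### Compiling bounded sums, blocks and loops -/

@[simp] theorem State.setReg_reg (s : State) (x v y : ℕ) :
    (s.setReg x v).reg y = if y = x then v else s.reg y := by
  simp [State.setReg, Function.update_apply]

@[simp] theorem State.setReg_arr (s : State) (x v : ℕ) : (s.setReg x v).arr = s.arr := rfl

@[simp] theorem State.setArr_reg (s : State) (A i j v : ℕ) : (s.setArr A i j v).reg = s.reg := rfl

theorem State.setArr_arr (s : State) (A i j v A' i' j' : ℕ) :
    (s.setArr A i j v).arr A' i' j' = if A' = A ∧ i' = i ∧ j' = j then v else s.arr A' i' j' := by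
  by_cases hA : A' = A <;> by_cases hi : i' = i <;> by_cases hj : j' = j <;>
    simp [State.setArr, hA, hi, hj]

/-- Expressions with bounded sums: `sum x y e` is the sum of `e` over all values of register `x`
below the value of register `y`. -/
inductive SumExpr
  | const : ℕ → SumExpr
  | reg : ℕ → SumExpr
  | cell : ℕ → SumExpr → SumExpr → SumExpr
  | add : SumExpr → SumExpr → SumExpr
  | sub : SumExpr → SumExpr → SumExpr
  | sum : ℕ → ℕ → SumExpr → SumExpr

namespace SumExpr

def eval : SumExpr → State → ℕ
  | const n, _ => n
  | reg x, s => s.reg x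
  | cell A i j, s => s.arr A (i.eval s) (j.eval s)
  | add a b, s => a.eval s + b.eval s
  | sub a b, s => a.eval s - b.eval s
  | sum x y e, s => ∑ v ∈ Finset.range (s.reg y), e.eval (s.setReg x v)

/-- Only registers below `32` occur; sums are bounded by register `0` or `1`, and bind neither. -/
def Valid : SumExpr → Prop
  | const _ => True
  | reg x => x < 32
  | cell _ i j => i.Valid ∧ j.Valid
  | add a b => a.Valid ∧ b.Valid
  | sub a b => a.Valid ∧ b.Valid
  | sum x y e => (2 ≤ x ∧ x < 32 ∧ y < 2) ∧ e.Valid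

/-- A program that stores the value of the expression in register `r`, using the registers from `r`
on as working memory. -/
def compile : SumExpr → ℕ → Program
  | const n, r => .assign r (.const n)
  | reg x, r => .assign r (.reg x)
  | cell A i j, r =>
      .seq (i.compile r) (.seq (j.compile (r + 1)) (.assign r (.cell A (.reg r) (.reg (r + 1)))))
  | add a b, r =>
      .seq (a.compile r) (.seq (b.compile (r + 1)) (.assign r (.add (.reg r) (.reg (r + 1)))))
  | sub a b, r =>
      .seq (a.compile r) (.seq (b.compile (r + 1)) (.assign r (.sub (.reg r) (.reg (r + 1)))))
  -- Register `r` accumulates the sum and `r + 1` saves the old content of `x`, which is restored at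
  -- the end; the body works from `r + 2` on.
  | sum x y e, r =>
      .seq (.assign r (.const 0)) (.seq (.assign (r + 1) (.reg x)) (.seq (.assign x (.const 0))
        (.seq (.loop (.sub (.reg y) (.reg x)) (.seq (e.compile (r + 2))
          (.seq (.assign r (.add (.reg r) (.reg (r + 2)))) (.assign x (.add (.reg x) (.const 1))))))
          (.assign x (.reg (r + 1))))))

open Polynomial in
/-- A bound on the running time of the compiled expression, in terms of a bound on the registers `0`
and `1`. -/
noncomputable def cost : SumExpr → Polynomial ℕ
  | const _ => 2
  | reg _ => 2
  | cell _ i j => i.cost + j.cost + 6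
  | add a b => a.cost + b.cost + 6
  | sub a b => a.cost + b.cost + 6
  -- Per round, `14` counts the test (3), two updates (4 each), two compositions and the loop
  -- itself. The `16` is made up of four assignments (2 each), four compositions and the final test
  -- (4).
  | sum _ _ e => X * (e.cost + 14) + 16

end SumExpr

/-- The arrays and the registers below `r` have the same contents. -/
def AgreeBelow (r : ℕ) (s s' : State) : Prop := s.arr = s'.arr ∧ ∀ x < r, s.reg x = s'.reg x

namespace AgreeBelow

variable {r : ℕ} {s s' s'' : State}

theorem refl (r : ℕ) (s : State) : AgreeBelow r s s := ⟨rfl, fun _ _ => rfl⟩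

theorem trans (h : AgreeBelow r s s') (h' : AgreeBelow r s' s'') : AgreeBelow r s s'' :=
  ⟨h.1.trans h'.1, fun x hx => (h.2 x hx).trans (h'.2 x hx)⟩

theorem mono {q : ℕ} (h : AgreeBelow r s s') (hq : q ≤ r) : AgreeBelow q s s' :=
  ⟨h.1, fun x hx => h.2 x (hx.trans_le hq)⟩

theorem setReg (h : AgreeBelow r s s') (x v : ℕ) :
    AgreeBelow r (s.setReg x v) (s'.setReg x v) := by
  refine ⟨h.1, fun y hy => ?_⟩
  simp only [State.setReg_reg]
  split_ifs
  · rfl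
  · exact h.2 y hy

theorem setReg_right (h : AgreeBelow r s s') {x : ℕ} (hx : r ≤ x) (v : ℕ) :
    AgreeBelow r s (s'.setReg x v) := by
  refine ⟨h.1, fun y hy => ?_⟩
  rw [State.setReg_reg, if_neg (by omega)]
  exact h.2 y hy

theorem setArr (h : AgreeBelow r s s') (A i j v : ℕ) :
    AgreeBelow r (s.setArr A i j v) (s'.setArr A i j v) :=
  ⟨by simp only [State.setArr, h.1], h.2⟩

end AgreeBelow

theorem SumExpr.eval_congr {e : SumExpr} (he : e.Valid) {r : ℕ} (hr : 32 ≤ r) {s s' : State}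
    (h : AgreeBelow r s s') : e.eval s = e.eval s' := by
  induction e generalizing s s' with
  | const n => rfl
  | reg x => exact h.2 x (lt_of_lt_of_le he hr)
  | cell A i j ihi ihj => simp only [eval, h.1, ihi he.1 h, ihj he.2 h]
  | add a b iha ihb => simp only [eval, iha he.1 h, ihb he.2 h]
  | sub a b iha ihb => simp only [eval, iha he.1 h, ihb he.2 h]
  | sum x y e ih =>
    obtain ⟨⟨h2, hx, hy⟩, he⟩ := he
    simp only [eval, h.2 y (by omega)]
    exact Finset.sum_congr rfl fun v _ => ih he (h.setReg x v)

/-- Induction on the number `d` of rounds that are left: after `v` rounds, `x` holds `v`, register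
`r` the partial sum, and `r + 1` the saved content of `x`. -/
theorem SumExpr.exec_loop {e : SumExpr} {x y r M B : ℕ} (hx : x < 32) (hy : y < 2) (hx2 : 2 ≤ x)
    (hr : 32 ≤ r) {s : State} (hB : s.reg y = B) (he : e.Valid)
    (ih : ∀ s' : State, s'.reg 0 = s.reg 0 → s'.reg 1 = s.reg 1 → ∃ n s'',
      Exec (e.compile (r + 2)) s' n s'' ∧ n ≤ M ∧ AgreeBelow (r + 2) s' s'' ∧
        s''.reg (r + 2) = e.eval s')
    (d : ℕ) : ∀ (v : ℕ) (s₁ : State), v + d = B → AgreeBelow r (s.setReg x v) s₁ →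
      s₁.reg r = ∑ u ∈ Finset.range v, e.eval (s.setReg x u) → s₁.reg (r + 1) = s.reg x →
      ∃ n s₂, Exec (.loop (.sub (.reg y) (.reg x)) (.seq (e.compile (r + 2))
          (.seq (.assign r (.add (.reg r) (.reg (r + 2))))
            (.assign x (.add (.reg x) (.const 1)))))) s₁ n s₂ ∧
        n ≤ d * (M + 14) + 4 ∧ AgreeBelow r (s.setReg x B) s₂ ∧
        s₂.reg r = ∑ u ∈ Finset.range B, e.eval (s.setReg x u) ∧ s₂.reg (r + 1) = s.reg x := by
  induction d with
  | zero =>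
    intro v s₁ hv hag hsum hsave
    obtain rfl : v = B := by omega
    have hx' := hag.2 x (by omega)
    have hy' := hag.2 y (by omega)
    simp only [State.setReg_reg, if_true, if_neg (show y ≠ x by omega)] at hx' hy'
    refine ⟨_, s₁, .loopDone ?_, by simp [Expr.cost], hag, hsum, hsave⟩
    simp only [Expr.eval]
    omega
  | succ d ihd =>
    intro v s₁ hv hag hsum hsave
    have hx' := hag.2 x (by omega)
    have hy' := hag.2 y (by omega)
    have h0 := hag.2 0 (by omega)
    have h1 := hag.2 1 (by omega)
    simp only [State.setReg_reg, if_true, if_neg (show y ≠ x by omega),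
      if_neg (show 0 ≠ x by omega), if_neg (show 1 ≠ x by omega)] at hx' hy' h0 h1
    obtain ⟨n₁, s₂, hex, hn₁, hag₂, hval⟩ := ih s₁ h0.symm h1.symm
    rw [← SumExpr.eval_congr he hr hag] at hval
    have hag₃ : AgreeBelow r (s.setReg x (v + 1))
        ((s₂.setReg r (s₂.reg r + s₂.reg (r + 2))).setReg x (s₂.reg x + 1)) := by
      have hsx : s₂.reg x = v := (hag₂.2 x (by omega)).symm.trans hx'.symm
      refine ⟨hag.1.trans hag₂.1, fun z hz => ?_⟩
      simp only [State.setReg_reg]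
      split_ifs with h₁ h₂
      · rw [hsx]
      · omega
      · rw [← hag₂.2 z (by omega), ← hag.2 z hz, State.setReg_reg, if_neg h₁]
    obtain ⟨n₂, s₃, hex', hn₂, hfin⟩ := ihd (v + 1) _ (by omega) hag₃
      (by
        rw [Finset.sum_range_succ, ← hsum, ← hval, hag₂.2 r (by omega)]
        simp [show r ≠ x by omega])
      (by
        rw [← hsave, hag₂.2 (r + 1) (by omega)]
        simp [show r + 1 ≠ x by omega])
    refine ⟨_, s₃, .loopStep ?_ (.seq hex (.seq (.assign _ _ _) (.assign _ _ _))) (by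
      simpa [Expr.eval, show x ≠ r by omega] using hex'), ?_, hfin⟩
    · simp only [Expr.eval]
      omega
    · simp only [Expr.cost]
      nlinarith

/-- The common pattern of `cell`, `add` and `sub`: the second operand is computed from register `r +
1` on, so the first one survives in `r`. -/
theorem SumExpr.exec_binary {i j : SumExpr} {r p q : ℕ} {s : State}
    (hi : ∃ n s', Exec (i.compile r) s n s' ∧ n ≤ p ∧ AgreeBelow r s s' ∧ s'.reg r = i.eval s)
    (hj : ∀ s', AgreeBelow r s s' → ∃ n s'', Exec (j.compile (r + 1)) s' n s'' ∧ n ≤ q ∧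
      AgreeBelow (r + 1) s' s'' ∧ s''.reg (r + 1) = j.eval s) (E : Expr) (hE : E.cost = 3) {v : ℕ}
    (hv : ∀ s', s'.arr = s.arr → s'.reg r = i.eval s → s'.reg (r + 1) = j.eval s →
      E.eval s' = v) :
    ∃ n s', Exec (.seq (i.compile r) (.seq (j.compile (r + 1)) (.assign r E))) s n s' ∧
      n ≤ p + q + 6 ∧ AgreeBelow r s s' ∧ s'.reg r = v := by
  obtain ⟨n₁, s₁, hex₁, hn₁, hag₁, hv₁⟩ := hi
  obtain ⟨n₂, s₂, hex₂, hn₂, hag₂, hv₂⟩ := hj s₁ hag₁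
  have hag := hag₁.trans (hag₂.mono (Nat.le_succ r))
  refine ⟨_, _, .seq hex₁ (.seq hex₂ (.assign _ _ _)), by omega, hag.setReg_right le_rfl _, ?_⟩
  rw [State.setReg_reg, if_pos rfl]
  exact hv s₂ hag.1.symm ((hag₂.2 r (Nat.lt_succ_self r)).symm.trans hv₁) hv₂

theorem SumExpr.exec_compile {e : SumExpr} (he : e.Valid) {r M : ℕ} (hr : 32 ≤ r) {s : State}
    (h0 : s.reg 0 ≤ M) (h1 : s.reg 1 ≤ M) :
    ∃ n s', Exec (e.compile r) s n s' ∧ n ≤ e.cost.eval M ∧ AgreeBelow r s s' ∧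
      s'.reg r = e.eval s := by
  induction e generalizing r s with
  | const n => exact ⟨_, _, .assign _ _ _, by simp [cost, Expr.cost],
      (AgreeBelow.refl r s).setReg_right le_rfl _, by simp [Expr.eval, eval]⟩
  | reg x => exact ⟨_, _, .assign _ _ _, by simp [cost, Expr.cost],
      (AgreeBelow.refl r s).setReg_right le_rfl _, by simp [Expr.eval, eval]⟩
  | cell A i j ihi ihj =>
    have hb : ∀ s', AgreeBelow r s s' → ∃ n s'', Exec (j.compile (r + 1)) s' n s'' ∧
        n ≤ j.cost.eval M ∧ AgreeBelow (r + 1) s' s'' ∧ s''.reg (r + 1) = j.eval s := by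
      intro s' hag
      rw [eval_congr he.2 hr hag]
      exact ihj he.2 (by omega) (hag.2 0 (by omega) ▸ h0) (hag.2 1 (by omega) ▸ h1)
    simpa [cost, compile] using exec_binary (ihi he.1 hr h0 h1) hb (.cell A (.reg r) (.reg (r + 1))) rfl
      fun s' h h' h'' => by simp only [Expr.eval, h, h', h'', eval]
  | add a b iha ihb =>
    have hb : ∀ s', AgreeBelow r s s' → ∃ n s'', Exec (b.compile (r + 1)) s' n s'' ∧
        n ≤ b.cost.eval M ∧ AgreeBelow (r + 1) s' s'' ∧ s''.reg (r + 1) = b.eval s := by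
      intro s' hag
      rw [eval_congr he.2 hr hag]
      exact ihb he.2 (by omega) (hag.2 0 (by omega) ▸ h0) (hag.2 1 (by omega) ▸ h1)
    simpa [cost, compile] using exec_binary (iha he.1 hr h0 h1) hb (.add (.reg r) (.reg (r + 1))) rfl
      fun s' _ h' h'' => by simp only [Expr.eval, h', h'', eval]
  | sub a b iha ihb =>
    have hb : ∀ s', AgreeBelow r s s' → ∃ n s'', Exec (b.compile (r + 1)) s' n s'' ∧
        n ≤ b.cost.eval M ∧ AgreeBelow (r + 1) s' s'' ∧ s''.reg (r + 1) = b.eval s := by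
      intro s' hag
      rw [eval_congr he.2 hr hag]
      exact ihb he.2 (by omega) (hag.2 0 (by omega) ▸ h0) (hag.2 1 (by omega) ▸ h1)
    simpa [cost, compile] using exec_binary (iha he.1 hr h0 h1) hb (.sub (.reg r) (.reg (r + 1))) rfl
      fun s' _ h' h'' => by simp only [Expr.eval, h', h'', eval]
  | sum x y e ih =>
    obtain ⟨⟨hx2, hx, hy⟩, he⟩ := he
    have hB : s.reg y ≤ M := by interval_cases y <;> assumption
    have hag : AgreeBelow r (s.setReg x 0)
        (((s.setReg r 0).setReg (r + 1) ((s.setReg r 0).reg x)).setReg x 0) :=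
      (((AgreeBelow.refl r s).setReg_right le_rfl _).setReg_right (by omega) _).setReg x 0
    obtain ⟨n, s₂, hex, hn, hag₂, hsum, hsave⟩ := SumExpr.exec_loop hx hy hx2 hr (s := s) rfl he
      (M := e.cost.eval M) (fun s' h0' h1' => ih he (by omega) (h0' ▸ h0) (h1' ▸ h1))
      (s.reg y) 0 _ (by omega) hag (by simp [show r ≠ x by omega])
      (by simp [show r + 1 ≠ x by omega, show x ≠ r by omega])
    refine ⟨_, _, .seq (.assign _ _ _) (.seq (.assign _ _ _) (.seq (.assign _ _ _)
      (.seq hex (.assign _ _ _)))), ?_, ?_, ?_⟩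
    · simp only [cost, Expr.cost, Polynomial.eval_add, Polynomial.eval_mul, Polynomial.eval_X,
        Polynomial.eval_ofNat]
      have : s.reg y * (e.cost.eval M + 14) ≤ M * (e.cost.eval M + 14) := by gcongr
      omega
    · refine ⟨hag₂.1, fun z hz => ?_⟩
      simp only [Expr.eval, State.setReg_reg, hsave]
      split_ifs with hzx
      · rw [hzx]
      · have := hag₂.2 z hz
        rwa [State.setReg_reg, if_neg hzx] at this
    · simp only [Expr.eval, State.setReg_reg, if_neg (show r ≠ x by omega), hsum]
      rfl

/-- Programs without loops over `SumExpr`. -/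
inductive Block
  | assign : ℕ → SumExpr → Block
  | store : ℕ → SumExpr → SumExpr → SumExpr → Block
  | seq : Block → Block → Block
  | ite : SumExpr → Block → Block → Block

namespace Block

def run : Block → State → State
  | assign x e, s => s.setReg x (e.eval s)
  | store A i j e, s => s.setArr A (i.eval s) (j.eval s) (e.eval s)
  | seq b c, s => c.run (b.run s)
  | ite e b c, s => if e.eval s ≠ 0 then b.run s else c.run s

def Valid : Block → Prop
  | assign x e => (2 ≤ x ∧ x < 32) ∧ e.Valid
  | store _ i j e => i.Valid ∧ j.Valid ∧ e.Valid
  | seq b c => b.Valid ∧ c.Valid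
  | ite e b c => e.Valid ∧ b.Valid ∧ c.Valid

def compile : Block → Program
  | assign x e => .seq (e.compile 32) (.assign x (.reg 32))
  -- Working memory starts one register later each time, so the indices in `32` and `33` are still
  -- there when the value is ready.
  | store A i j e => .seq (i.compile 32) (.seq (j.compile 33) (.seq (e.compile 34)
      (.store A (.reg 32) (.reg 33) (.reg 34))))
  | seq b c => .seq b.compile c.compile
  | ite e b c => .seq (e.compile 32) (.ite (.reg 32) b.compile c.compile)

noncomputable def cost : Block → Polynomial ℕ
  | assign _ e => e.cost + 3
  | store _ i j e => i.cost + j.cost + e.cost + 7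
  | seq b c => b.cost + c.cost + 1
  | ite e b c => e.cost + b.cost + c.cost + 3

theorem run_reg {b : Block} (hb : b.Valid) (s : State) {x : ℕ} (hx : x < 2) :
    (b.run s).reg x = s.reg x := by
  induction b generalizing s with
  | assign y e =>
    have := hb.1.1
    rw [run, State.setReg_reg, if_neg (by omega)]
  | store A i j e => rfl
  | seq b c ihb ihc => rw [run, ihc hb.2, ihb hb.1]
  | ite e b c ihb ihc =>
    rw [run]
    split_ifs
    · exact ihb hb.2.1 s
    · exact ihc hb.2.2 s

end Block

/-- Up to the contents of the registers from `32` on, `c` takes `σ` to `σ'` in at most `n` steps. -/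
def Simulates (c : Program) (σ : State) (n : ℕ) (σ' : State) : Prop :=
  ∀ s, AgreeBelow 32 σ s → ∃ n' s', Exec c s n' s' ∧ n' ≤ n ∧ AgreeBelow 32 σ' s'

theorem Simulates.mono {c : Program} {σ σ' : State} {n n' : ℕ} (h : Simulates c σ n σ')
    (hn : n ≤ n') : Simulates c σ n' σ' := fun s hs =>
  let ⟨k, s', hex, hk, hs'⟩ := h s hs
  ⟨k, s', hex, hk.trans hn, hs'⟩

theorem Simulates.seq {c d : Program} {σ σ' σ'' : State} {n n' : ℕ} (h : Simulates c σ n σ')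
    (h' : Simulates d σ' n' σ'') : Simulates (.seq c d) σ (n + n' + 1) σ'' := by
  intro s hs
  obtain ⟨k, s', hex, hk, hs'⟩ := h s hs
  obtain ⟨k', s'', hex', hk', hs''⟩ := h' s' hs'
  exact ⟨_, s'', .seq hex hex', by omega, hs''⟩

theorem Block.simulates {b : Block} (hb : b.Valid) {M : ℕ} {σ : State} (h0 : σ.reg 0 ≤ M)
    (h1 : σ.reg 1 ≤ M) : Simulates b.compile σ (b.cost.eval M) (b.run σ) := by
  have key : ∀ {e : SumExpr} {r : ℕ} {s : State}, e.Valid → 32 ≤ r → AgreeBelow 32 σ s →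
      ∃ n s', Exec (e.compile r) s n s' ∧ n ≤ e.cost.eval M ∧ AgreeBelow r s s' ∧
        s'.reg r = e.eval σ := by
    intro e r s he hr hs
    rw [SumExpr.eval_congr he le_rfl hs]
    exact SumExpr.exec_compile he hr (hs.2 0 (by omega) ▸ h0) (hs.2 1 (by omega) ▸ h1)
  induction b generalizing σ with
  | assign x e =>
    intro s hs
    obtain ⟨n, s', hex, hn, hag, hv⟩ := key hb.2 le_rfl hs
    refine ⟨_, _, .seq hex (.assign _ _ _), ?_, ?_⟩
    · simp only [cost, Expr.cost, Polynomial.eval_add, Polynomial.eval_ofNat]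
      omega
    · simp only [Expr.eval, hv]
      exact (hs.trans hag).setReg _ _
  | store A i j e =>
    intro s hs
    obtain ⟨n₁, s₁, hex₁, hn₁, hag₁, hv₁⟩ := key hb.1 le_rfl hs
    obtain ⟨n₂, s₂, hex₂, hn₂, hag₂, hv₂⟩ := key hb.2.1 (r := 33) (by omega) (hs.trans hag₁)
    have hs₂ := (hs.trans hag₁).trans (hag₂.mono (by omega))
    obtain ⟨n₃, s₃, hex₃, hn₃, hag₃, hv₃⟩ := key hb.2.2 (r := 34) (by omega) hs₂
    refine ⟨_, _, .seq hex₁ (.seq hex₂ (.seq hex₃ (.store _ _ _ _ _))), ?_, ?_⟩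
    · simp only [cost, Expr.cost, Polynomial.eval_add, Polynomial.eval_ofNat]
      omega
    · simp only [Expr.eval, hv₃, ← hag₃.2 33 (by omega), hv₂, ← hag₃.2 32 (by omega),
        ← hag₂.2 32 (by omega), hv₁]
      exact (hs₂.trans (hag₃.mono (by omega))).setArr _ _ _ _
  | seq b c ihb ihc =>
    have h0' := b.run_reg hb.1 σ (x := 0) (by omega)
    have h1' := b.run_reg hb.1 σ (x := 1) (by omega)
    refine ((ihb hb.1 h0 h1 key).seq (ihc hb.2 (h0' ▸ h0) (h1' ▸ h1) ?_)).mono ?_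
    · intro e r s he hr hs
      rw [SumExpr.eval_congr he le_rfl hs]
      exact SumExpr.exec_compile he hr (hs.2 0 (by omega) ▸ h0' ▸ h0)
        (hs.2 1 (by omega) ▸ h1' ▸ h1)
    · simp only [cost, Polynomial.eval_add, Polynomial.eval_one]
      exact le_rfl
  | ite e b c ihb ihc =>
    intro s hs
    obtain ⟨n, s₁, hex, hn, hag, hv⟩ := key hb.1 le_rfl hs
    simp only [run, cost, Polynomial.eval_add, Polynomial.eval_ofNat]
    split_ifs with h
    · obtain ⟨n', s₂, hex', hn', hag'⟩ := ihb hb.2.1 h0 h1 key s₁ (hs.trans hag)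
      refine ⟨_, s₂, .seq hex (.iteTrue (by rwa [Expr.eval, hv]) hex'), ?_, hag'⟩
      simp only [Expr.cost]
      omega
    · obtain ⟨n', s₂, hex', hn', hag'⟩ := ihc hb.2.2 h0 h1 key s₁ (hs.trans hag)
      refine ⟨_, s₂, .seq hex (.iteFalse (by rw [Expr.eval, hv]; exact not_not.1 h) hex'), ?_, hag'⟩
      simp only [Expr.cost]
      omega

/-- The index of the invariant drops in every round, so it bounds the number of rounds; each costs
the body plus two steps for the test and the loop, and the extra `1` pays for the final test. -/
theorem Block.simulates_loop {b : Block} (hb : b.Valid) {M x : ℕ} (hx : x < 32)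
    {I : ℕ → State → Prop}
    (hstep : ∀ μ σ, I μ σ → σ.reg x ≠ 0 → ∃ μ' < μ, I μ' (b.run σ)) {μ : ℕ} {σ : State}
    (hI : I μ σ) (h0 : σ.reg 0 ≤ M) (h1 : σ.reg 1 ≤ M) :
    ∃ σ' μ', Simulates (.loop (.reg x) b.compile) σ ((μ + 1) * (b.cost.eval M + 2)) σ' ∧ I μ' σ' ∧
      σ'.reg x = 0 ∧ σ'.reg 0 = σ.reg 0 ∧ σ'.reg 1 = σ.reg 1 := by
  induction μ using Nat.strong_induction_on generalizing σ with
  | _ μ ih =>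
    by_cases hσ : σ.reg x = 0
    · refine ⟨σ, μ, fun s hs => ⟨_, s, .loopDone ?_, ?_, hs⟩, hI, hσ, rfl, rfl⟩
      · rw [Expr.eval, ← hs.2 x hx, hσ]
      · simp only [Expr.cost]
        nlinarith
    · obtain ⟨μ', hμ, hI'⟩ := hstep μ σ hI hσ
      have h0' := b.run_reg hb σ (x := 0) (by omega)
      have h1' := b.run_reg hb σ (x := 1) (by omega)
      obtain ⟨σ', ν, hsim, hfin, hx', h0'', h1''⟩ := ih μ' hμ hI' (h0' ▸ h0) (h1' ▸ h1)
      refine ⟨σ', ν, fun s hs => ?_, hfin, hx', h0''.trans h0', h1''.trans h1'⟩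
      obtain ⟨n₁, s₁, hex₁, hn₁, hag₁⟩ := b.simulates hb h0 h1 s hs
      obtain ⟨n₂, s₂, hex₂, hn₂, hag₂⟩ := hsim s₁ hag₁
      refine ⟨_, s₂, .loopStep ?_ hex₁ hex₂, ?_, hag₂⟩
      · rwa [Expr.eval, ← hs.2 x hx]
      · simp only [Expr.cost]
        have : (μ' + 2) * (b.cost.eval M + 2) ≤ (μ + 1) * (b.cost.eval M + 2) :=
          Nat.mul_le_mul_right _ (by omega)
        nlinarith

/-! ### Removing the candidates one by one -/

section

variable {N C : Type*} [Fintype C] [DecidableEq C] {P : Profile N C}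

/-- The candidates that are left when `a` with `ord a = τ` is removed; `ord` decreases in the order
of removal, and is `0` for the candidates that have not been removed. -/
def remaining (ord : C → ℕ) (τ : ℕ) : Finset C := Finset.univ.filter fun c => ord c ≤ τ

omit [DecidableEq C] in
theorem mem_remaining {ord : C → ℕ} {τ : ℕ} {c : C} : c ∈ remaining ord τ ↔ ord c ≤ τ := by
  simp [remaining]

/-- The arcs from the removed candidates to their attachment sets. -/
def removalDigraph (P : Profile N C) (ord : C → ℕ) : Digraph C :=
  ⟨fun a b => ord a ≠ 0 ∧ b ∈ P.attachSet (remaining ord (ord a)) a⟩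

/-- Every removed candidate is ranked last by some voter at the time of its removal, and has a
nonempty attachment set. -/
structure IsRemovalOrder (P : Profile N C) (ord : C → ℕ) : Prop where
  mem_bottoms : ∀ a, ord a ≠ 0 → a ∈ P.bottoms (remaining ord (ord a))
  nonempty : ∀ a, ord a ≠ 0 → (P.attachSet (remaining ord (ord a)) a).Nonempty
  injOn : ∀ a b, ord a ≠ 0 → ord a = ord b → a = b

theorem remaining_sdiff {ord : C → ℕ} {a : C} {τ : ℕ} (ha : ord a = τ + 1)
    (hinj : ∀ b, ord b = τ + 1 → b = a) : remaining ord (τ + 1) \ {a} = remaining ord τ := by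
  ext c
  simp only [Finset.mem_sdiff, mem_remaining, Finset.mem_singleton]
  constructor
  · rintro ⟨h, hca⟩
    have : ord c ≠ τ + 1 := fun h => hca (hinj c h)
    omega
  · intro h
    exact ⟨by omega, by rintro rfl; omega⟩

omit [DecidableEq C] in
theorem remaining_succ {ord : C → ℕ} {τ : ℕ} (h : ∀ b, ord b ≠ τ + 1) :
    remaining ord (τ + 1) = remaining ord τ := by
  ext c
  have := h c
  simp only [mem_remaining]
  omega

/-- Induction against the order of removal, with the digraph cut off at time `τ`; unused times
change nothing. A single candidate is never in its own attachment set, so singleton layers satisfy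
the disjointness condition down to the last two candidates. -/
theorem IsRemovalOrder.peelRun [Nonempty N] {ord : C → ℕ} (h : IsRemovalOrder P ord)
    (h1 : (remaining ord 0).card ≤ 1) (τ : ℕ) :
    P.PeelRun (remaining ord τ) ⟨fun a b => ord a ≤ τ ∧ (removalDigraph P ord).Adj a b⟩ := by
  classical
  induction τ with
  | zero =>
    convert Profile.PeelRun.single (P := P) _ h1 using 4 with a b
    simp only [removalDigraph, iff_false]
    rintro ⟨h2, h3, -⟩
    omega
  | succ τ ih =>
    by_cases hex : ∃ a, ord a = τ + 1
    · obtain ⟨a, ha⟩ := hex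
      have hinj : ∀ b, ord b = τ + 1 → b = a := fun b hb => h.injOn b a (by omega) (by omega)
      have hbot := h.mem_bottoms a (by omega)
      rw [ha] at hbot
      rw [← remaining_sdiff ha hinj] at ih
      have hstep := Profile.PeelRun.step (P := P) (remaining ord (τ + 1)) {a} _
        (by simpa using hbot)
        (by
          intro b hb
          obtain rfl := Finset.mem_singleton.1 hb
          exact ha ▸ h.nonempty b (by omega))
        (by
          intro b hb
          obtain rfl := Finset.mem_singleton.1 hb
          rw [Finset.disjoint_singleton_right]
          intro hb'
          exact ((Profile.mem_attachSet (P.bottoms_subset _ hbot)).1 hb').2.1 rfl)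
        (by convert ih)
      convert hstep using 4 with x y
      simp only [removalDigraph, Finset.mem_singleton]
      constructor
      · rintro ⟨hx, hx0, hy⟩
        rcases hx.lt_or_eq with hx' | hx'
        · exact .inr ⟨by omega, hx0, hy⟩
        · exact .inl ⟨hinj x hx', hx' ▸ hy⟩
      · rintro (⟨rfl, hy⟩ | ⟨hx, hx0, hy⟩)
        · exact ⟨ha.le, by omega, ha ▸ hy⟩
        · exact ⟨by omega, hx0, hy⟩
    · push Not at hex
      rw [remaining_succ hex]
      convert ih using 4 with x y
      have : ord x ≤ τ + 1 ↔ ord x ≤ τ := by have := hex x; omega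
      rw [this]

omit [DecidableEq C] in
theorem exists_remaining_eq_univ (ord : C → ℕ) : ∃ τ, ∀ a, ord a ≤ τ :=
  ⟨Finset.univ.sup ord, fun a => Finset.le_sup (Finset.mem_univ a)⟩

theorem IsRemovalOrder.orientsTrees [Nonempty N] {ord : C → ℕ} (h : IsRemovalOrder P ord) {t : C}
    (ht : ord t = 0) (h1 : (remaining ord 0).card ≤ 1) :
    OrientsTrees P (removalDigraph P ord) t := by
  have : Nonempty C := ⟨t⟩
  obtain ⟨τ, hτ⟩ := exists_remaining_eq_univ ord
  have hrun := h.peelRun h1 τ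
  have huniv : remaining ord τ = Finset.univ := by ext a; simp [mem_remaining, hτ a]
  have hD : (⟨fun a b => ord a ≤ τ ∧ (removalDigraph P ord).Adj a b⟩ : Digraph C) =
      removalDigraph P ord := by
    simp [hτ]
  rw [huniv, hD] at hrun
  obtain ⟨s, hs⟩ := hrun.exists_orientsTrees
  obtain rfl : s = t := by
    by_contra hst
    have hs0 : ord s ≠ 0 := fun hs0 => hst
      (Finset.card_le_one.1 h1 s (mem_remaining.2 hs0.le) t (mem_remaining.2 ht.le))
    obtain ⟨b, hb⟩ := h.nonempty s hs0
    exact hs.isSink b ⟨hs0, hb⟩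
  exact hs

theorem IsRemovalOrder.hasUniqueBetterNeighbor [Nonempty N] {ord : C → ℕ}
    (h : IsRemovalOrder P ord) {T : SimpleGraph C} (hT : P.HasUniqueBetterNeighbor Finset.univ T) :
    P.HasUniqueBetterNeighbor (remaining ord 0) T := by
  have key : ∀ τ, P.HasUniqueBetterNeighbor (remaining ord τ) T →
      P.HasUniqueBetterNeighbor (remaining ord 0) T := by
    intro τ
    induction τ with
    | zero => exact id
    | succ τ ih =>
      intro hτ
      apply ih
      by_cases hex : ∃ a, ord a = τ + 1
      · obtain ⟨a, ha⟩ := hex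
        rw [← remaining_sdiff ha fun b hb => h.injOn b a (by omega) (by omega)]
        have hbot := h.mem_bottoms a (by omega)
        rw [ha] at hbot
        convert hτ.sdiff (L := {a}) (by simpa using hbot)
      · push Not at hex
        rwa [← remaining_succ hex]
  obtain ⟨τ, hτ⟩ := exists_remaining_eq_univ ord
  refine key τ ?_
  have huniv : remaining ord τ = Finset.univ := by ext a; simp [mem_remaining, hτ a]
  rwa [huniv]

/-- A failure halfway is conclusive: a tree would restrict to the remaining candidates, where the
neighbour of the leaf `a` lies in its attachment set. -/
theorem IsRemovalOrder.trees_eq_empty [Nonempty N] {ord : C → ℕ} (h : IsRemovalOrder P ord) {a c : C}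
    (ha : a ∈ P.bottoms (remaining ord 0)) (hc : ord c = 0) (hca : c ≠ a)
    (he : P.attachSet (remaining ord 0) a = ∅) : ¬ P.trees.Nonempty := by
  have : Nonempty C := ⟨a⟩
  rintro ⟨T, hT⟩
  obtain ⟨b, hb, -⟩ := (h.hasUniqueBetterNeighbor (Profile.mem_trees_iff.1 hT)).exists_leaf ha
    (mem_remaining.2 hc.le) hca
  rw [he] at hb
  exact absurd hb (Finset.notMem_empty b)

/-- The new time `v` lies below all earlier ones, so the sets remaining at earlier removals contain
`a` before and after the change, and their arcs stay the same. -/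
theorem IsRemovalOrder.update {ord : C → ℕ} (h : IsRemovalOrder P ord) {a : C} {v : ℕ} (hv : v ≠ 0)
    (hlt : ∀ b, ord b ≠ 0 → v < ord b) (ha0 : ord a = 0) (ha : a ∈ P.bottoms (remaining ord 0))
    (hne : (P.attachSet (remaining ord 0) a).Nonempty) :
    (∀ c, (removalDigraph P (Function.update ord a v)).Adj a c ↔
        c ∈ P.attachSet (remaining ord 0) a) ∧
      (∀ b, b ≠ a → ∀ c, (removalDigraph P (Function.update ord a v)).Adj b c ↔
        (removalDigraph P ord).Adj b c) ∧
      IsRemovalOrder P (Function.update ord a v) := by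
  have hother : ∀ b, ord b ≠ 0 → Function.update ord a v b = ord b := fun b hb =>
    Function.update_of_ne (by rintro rfl; exact hb ha0) _ _
  have hrem : ∀ b, ord b ≠ 0 ∨ b = a →
      remaining (Function.update ord a v) (Function.update ord a v b) =
        remaining ord (ord b) := by
    rintro b (hb | rfl)
    · rw [hother b hb]
      ext c
      simp only [mem_remaining, Function.update_apply]
      have := hlt b hb
      split_ifs with hca
      · subst hca; omega
      · rfl
    · ext c
      simp only [mem_remaining, Function.update_apply, if_true]
      have := hlt c
      split_ifs with hca
      · subst hca; omega
      · omega
  have hcase : ∀ b, Function.update ord a v b ≠ 0 → ord b ≠ 0 ∨ b = a := by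
    intro b hb
    by_cases hba : b = a
    · exact .inr hba
    · rw [Function.update_of_ne hba] at hb
      exact .inl hb
  refine ⟨fun c => ?_, fun b hba c => ?_, ⟨fun b hb => ?_, fun b hb => ?_, fun b c hb hbc => ?_⟩⟩
  · simp only [removalDigraph]
    rw [hrem a (.inr rfl), ha0, Function.update_self]
    exact and_iff_right hv
  · simp only [removalDigraph]
    rw [Function.update_of_ne hba]
    refine and_congr_right fun hb => ?_
    have := hrem b (.inl hb)
    rw [Function.update_of_ne hba] at this
    rw [this]
  · rw [hrem b (hcase b hb)]
    rcases hcase b hb with h' | rfl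
    · exact h.mem_bottoms b h'
    · rwa [ha0]
  · rw [hrem b (hcase b hb)]
    rcases hcase b hb with h' | rfl
    · exact h.nonempty b h'
    · rwa [ha0]
  · rcases hcase b hb with h' | rfl <;> rcases hcase c (hbc ▸ hb) with h'' | rfl
    · exact h.injOn b c h' (by rwa [hother b h', hother c h''] at hbc)
    · rw [hother b h', Function.update_self] at hbc
      exact absurd hbc (hlt b h').ne'
    · rw [hother c h'', Function.update_self] at hbc
      exact absurd hbc (hlt c h'').ne
    · rfl

end

/-! ### Pushing and relabelling -/

section

variable {C : Type*} [Fintype C] [DecidableEq C]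

/-- The number of candidates other than `t` that are mapped to `b`. -/
def loadOff (t : C) (F : C → C) (b : C) : ℕ := (Finset.univ.filter fun a => a ≠ t ∧ F a = b).card

theorem load_restrict (t : C) (F : C → C) (b : C) :
    load (fun a : {a : C // a ≠ t} => F a) b = loadOff t F b := by
  rw [load, loadOff, ← Finset.card_map (Function.Embedding.subtype _)]
  congr 1
  ext a
  simp [and_comm]

/-- The invariants of the assignment `F` and the labels `d`. -/
structure IsValidLabelling (D : Digraph C) (t : C) (cap : C → ℕ) (F : C → C) (d : C → ℕ) :
    Prop where
  arc : ∀ a, a ≠ t → D.Adj a (F a)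
  -- Moving `a` from `F a` to `b` is a residual arc, along which labels drop by at most one.
  -- Together with label `0` at spare capacity, this makes a label a lower bound for the number of
  -- moves needed to get rid of an excess.
  le_succ : ∀ a, a ≠ t → ∀ b, D.Adj a b → d (F a) ≤ d b + 1
  eq_zero : ∀ b, loadOff t F b < cap b → d b = 0
  le_card : ∀ b, d b ≤ Fintype.card C

/-- A potential that decreases with every push and with every relabelling. -/
def labelPotential (t : C) (F : C → C) (d : C → ℕ) : ℕ :=
  ∑ a ∈ Finset.univ.filter (· ≠ t), d (F a) +
    -- Raising one label increases the first sum by at most `|C|`, which the factor `|C| + 1`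
    -- outweighs. Labels are at most `|C|`, so the subtraction does not truncate.
    (Fintype.card C + 1) * (Fintype.card C * Fintype.card C - ∑ b, d b)

variable {D : Digraph C} {t : C} {cap : C → ℕ} {F : C → C} {d : C → ℕ}

theorem IsValidLabelling.push (h : IsValidLabelling D t cap F d) {a b : C} (ha : a ≠ t)
    (hover : cap (F a) < loadOff t F (F a)) (hab : D.Adj a b) (hd : d (F a) = d b + 1) :
    IsValidLabelling D t cap (Function.update F a b) d ∧
      labelPotential t (Function.update F a b) d < labelPotential t F d := by
  refine ⟨⟨fun c hc => ?_, fun c hc e hce => ?_, fun c hc => ?_, h.le_card⟩, ?_⟩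
  · rw [Function.update_apply]
    split_ifs with hca
    · rwa [hca]
    · exact h.arc c hc
  · have := h.le_succ c hc e hce
    rw [Function.update_apply]
    split_ifs with hca
    · subst hca; omega
    · exact this
  -- Only `F a` loses load, and being overloaded it is still full after losing one; no other
  -- candidate gains spare capacity.
  · by_cases hcF : c = F a
    · subst hcF
      have hsub : (Finset.univ.filter fun x => x ≠ t ∧ F x = F a) ⊆
          insert a (Finset.univ.filter fun x => x ≠ t ∧ Function.update F a b x = F a) := by
        intro x hx
        by_cases hxa : x = a <;> simp_all [Function.update_apply]
      have := (Finset.card_le_card hsub).trans (Finset.card_insert_le _ _)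
      simp only [loadOff] at *
      omega
    · refine h.eq_zero c (lt_of_le_of_lt (Finset.card_le_card fun x hx => ?_) hc)
      simp only [Finset.mem_filter, Finset.mem_univ, true_and] at hx ⊢
      refine ⟨hx.1, ?_⟩
      rw [Function.update_of_ne, hx.2]
      rintro rfl
      exact hcF hx.2.symm
  · rw [labelPotential, labelPotential, Nat.add_lt_add_iff_right]
    refine Finset.sum_lt_sum (fun x _ => ?_) ⟨a, by simpa using ha, ?_⟩
    · rw [Function.update_apply]
      split_ifs with hxa
      · subst hxa; omega
      · exact le_rfl
    · rw [Function.update_self]; omega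

/-- Since no move out of `b` leads exactly one label down, every such move has room for raising the
label of `b`; being overloaded, `b` is not among the candidates whose label must be `0`. -/
theorem IsValidLabelling.relabel (h : IsValidLabelling D t cap F d) {b : C}
    (hover : cap b < loadOff t F b) (hlt : d b < Fintype.card C)
    (hno : ∀ a, a ≠ t → F a = b → ∀ c, D.Adj a c → d b ≠ d c + 1) :
    IsValidLabelling D t cap F (Function.update d b (d b + 1)) ∧
      labelPotential t F (Function.update d b (d b + 1)) < labelPotential t F d := by
  have hge : ∀ c, d c ≤ Function.update d b (d b + 1) c := by
    intro c
    rw [Function.update_apply]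
    split_ifs with hcb
    · subst hcb; omega
    · exact le_rfl
  have hcard : ∀ c, Function.update d b (d b + 1) c ≤ Fintype.card C := by
    intro c
    rw [Function.update_apply]
    split_ifs with hcb
    · omega
    · exact h.le_card c
  refine ⟨⟨h.arc, fun c hc e hce => ?_, fun c hc => ?_, hcard⟩, ?_⟩
  · have h1 := h.le_succ c hc e hce
    have h2 := hge e
    by_cases hcb : F c = b
    · have := hno c hc hcb e hce
      rw [hcb] at h1 ⊢
      rw [Function.update_self]
      omega
    · rw [Function.update_of_ne hcb]
      omega
  · rw [Function.update_of_ne (by rintro rfl; omega)]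
    exact h.eq_zero c hc
  · have h1 : ∑ c, Function.update d b (d b + 1) c = ∑ c, d c + 1 := by
      rw [Finset.sum_update_of_mem (Finset.mem_univ b), ← Finset.add_sum_erase _ d
        (Finset.mem_univ b), ← Finset.erase_eq]
      omega
    have h2 : ∑ c, Function.update d b (d b + 1) c ≤ Fintype.card C * Fintype.card C := by
      simpa using Finset.sum_le_card_nsmul Finset.univ _ _ fun c _ => hcard c
    have h3 : ∑ a ∈ Finset.univ.filter (· ≠ t), Function.update d b (d b + 1) (F a) ≤
        ∑ a ∈ Finset.univ.filter (· ≠ t), d (F a) + Fintype.card C := by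
      have : ∀ a ∈ Finset.univ.filter (· ≠ t), Function.update d b (d b + 1) (F a) ≤
          d (F a) + 1 := by
        intro a _
        rw [Function.update_apply]
        split_ifs with hab
        · rw [hab]
        · omega
      refine (Finset.sum_le_sum this).trans ?_
      rw [Finset.sum_add_distrib, Finset.sum_const, smul_eq_mul, mul_one]
      exact Nat.add_le_add_left (Finset.card_le_univ _) _
    have h4 : Fintype.card C * Fintype.card C - ∑ c, d c =
        Fintype.card C * Fintype.card C - ∑ c, Function.update d b (d b + 1) c + 1 := by omega
    rw [labelPotential, labelPotential, h4, mul_add]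
    omega

/-- A gap in the labels gives a violation of Hall's condition: nothing assigned above the gap can be
moved below it, while the candidates above it are all full and `b` is overfull. -/
theorem IsValidLabelling.not_exists (h : IsValidLabelling D t cap F d) {b : C}
    (hover : cap b < loadOff t F b) (hb : Fintype.card C ≤ d b) {G : C → C}
    (hG : ∀ a, a ≠ t → D.Adj a (G a)) (hcap : ∀ c, loadOff t G c ≤ cap c) : False := by
  -- The `|C| - 1` candidates other than `b` cannot take all `|C|` values below `|C|`, and the label
  -- of `b` is not among these values.
  obtain ⟨j, hj, hjd⟩ : ∃ j ∈ Finset.range (Fintype.card C),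
      j ∉ (Finset.univ.erase b).image d := by
    apply Finset.exists_mem_notMem_of_card_lt_card
    refine Finset.card_image_le.trans_lt ?_
    rw [Finset.card_range, Finset.card_erase_of_mem (Finset.mem_univ b), Finset.card_univ]
    have : 0 < Fintype.card C := Fintype.card_pos_iff.2 ⟨b⟩
    omega
  have hj : j < Fintype.card C := Finset.mem_range.1 hj
  have hne : ∀ c, d c ≠ j := by
    intro c hc
    by_cases hcb : c = b
    · subst hcb; omega
    · exact hjd (Finset.mem_image.2 ⟨c, Finset.mem_erase.2 ⟨hcb, Finset.mem_univ c⟩, hc⟩)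
  set X : Finset C := Finset.univ.filter fun c => j < d c with hX
  set Y : Finset C := Finset.univ.filter fun a => a ≠ t ∧ F a ∈ X with hY
  have hYF : ∀ a ∈ Y, F a ∈ X := fun a ha => (Finset.mem_filter.1 ha).2.2
  -- The label of `F a` exceeds `j`, so that of `G a` is at least `j`, and it is not `j`.
  have hYG : ∀ a ∈ Y, G a ∈ X := by
    intro a ha
    have h1 := (Finset.mem_filter.1 (hYF a ha)).2
    have hat := (Finset.mem_filter.1 ha).2.1
    have h2 := h.le_succ a hat _ (hG a hat)
    have h3 := hne (G a)
    exact Finset.mem_filter.2 ⟨Finset.mem_univ _, by omega⟩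
  have h1 : Y.card = ∑ c ∈ X, loadOff t F c := by
    rw [Finset.card_eq_sum_card_fiberwise hYF]
    refine Finset.sum_congr rfl fun c hc => ?_
    rw [loadOff]
    congr 1
    ext a
    simp only [hY, Finset.mem_filter, Finset.mem_univ, true_and]
    grind
  have h2 : Y.card ≤ ∑ c ∈ X, loadOff t G c := by
    rw [Finset.card_eq_sum_card_fiberwise hYG]
    refine Finset.sum_le_sum fun c hc => Finset.card_le_card fun a ha => ?_
    simp only [hY, Finset.mem_filter, Finset.mem_univ, true_and] at ha ⊢
    exact ⟨ha.1.1, ha.2⟩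
  have h3 : ∑ c ∈ X, cap c < ∑ c ∈ X, loadOff t F c := by
    refine Finset.sum_lt_sum (fun c hc => ?_) ⟨b, by simp [hX]; omega, hover⟩
    by_contra hlt
    have := h.eq_zero c (not_le.1 hlt)
    have := (Finset.mem_filter.1 hc).2
    omega
  have h4 : ∑ c ∈ X, loadOff t G c ≤ ∑ c ∈ X, cap c := Finset.sum_le_sum fun c _ => hcap c
  omega

theorem IsValidLabelling.treesMaxDegree_eq_empty {N : Type*} {P : Profile N C} {k : ℕ} (hk : 1 ≤ k)
    (hD : OrientsTrees P D t) (h : IsValidLabelling D t (capacity t k) F d) {b : C}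
    (hover : capacity t k b < loadOff t F b) (hb : Fintype.card C ≤ d b) :
    ¬ (P.treesMaxDegree k).Nonempty := by
  rintro ⟨T, hT⟩
  obtain ⟨f, hf, hl, rfl⟩ := (hD.mem_treesMaxDegree hk).1 hT
  have hf' : (fun a : {a : C // a ≠ t} => if h : (a : C) ≠ t then f ⟨a, h⟩ else t) = f := by
    funext a
    simp [a.2]
  refine h.not_exists hover hb (G := fun a => if h : a ≠ t then f ⟨a, h⟩ else t) (fun a ha => ?_)
    fun c => ?_
  · simpa [ha] using hf ⟨a, ha⟩
  · rw [← load_restrict]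
    simp only [hf', hl]

theorem IsValidLabelling.mem_treesMaxDegree {N : Type*} {P : Profile N C} {k : ℕ} (hk : 1 ≤ k)
    (hD : OrientsTrees P D t) (h : IsValidLabelling D t (capacity t k) F d)
    (hle : ∀ b, loadOff t F b ≤ capacity t k b) :
    treeOf t (fun a => F a) ∈ P.treesMaxDegree k :=
  (hD.mem_treesMaxDegree hk).2 ⟨_, fun a => h.arc a a.2, fun b => load_restrict t F b ▸ hle b, rfl⟩

end

/-! ### Tests and searches as arithmetic expressions -/

theorem Profile.pos_lt_pos_iff {N C : Type*} [Finite C] (P : Profile N C) (i : N) {a b : C} :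
    P.pos i a < P.pos i b ↔ P.prefers i a b := by
  have key : ∀ {a b}, P.prefers i a b → P.pos i a < P.pos i b := by
    intro a b hab
    refine Nat.succ_lt_succ (Set.ncard_lt_ncard ?_ (Set.toFinite _))
    refine ⟨fun c hc => P.prefers_trans hc hab, fun h => P.prefers_irrefl i a (h hab)⟩
  refine ⟨fun h => ?_, key⟩
  by_contra hab
  by_cases heq : a = b
  · subst heq; exact lt_irrefl _ h
  · exact lt_asymm h (key ((P.prefers_or_prefers i heq).resolve_left hab))

theorem Profile.mem_bottoms {N C : Type*} {P : Profile N C} {S : Finset C} {a : C} :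
    a ∈ P.bottoms S ↔ a ∈ S ∧ ∃ i, ∀ b ∈ S, b ≠ a → P.prefers i b a := by
  classical
  rw [bottoms, Finset.mem_filter]
  refine and_congr_right fun ha => exists_congr fun i => ?_
  rw [IsBottom]
  exact and_iff_right ha

namespace SumExpr

/-- An expression, read as a truth value. -/
def Holds (e : SumExpr) (s : State) : Prop := e.eval s ≠ 0

def not (e : SumExpr) : SumExpr := .sub (.const 1) e

def and (a b : SumExpr) : SumExpr := not (.add (not a) (not b))

def lt (a b : SumExpr) : SumExpr := .sub b a

def eq (a b : SumExpr) : SumExpr := not (.add (.sub a b) (.sub b a))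

variable {a b e : SumExpr} {s : State} {x y : ℕ}

theorem eval_reg : (reg x).eval s = s.reg x := rfl

theorem eval_const {v : ℕ} : (const v).eval s = v := rfl

theorem eval_cell {A : ℕ} : (cell A a b).eval s = s.arr A (a.eval s) (b.eval s) := rfl

theorem eval_not : (not e).eval s = if e.eval s = 0 then 1 else 0 := by
  simp only [not, eval]
  split_ifs <;> omega

theorem holds_not : (not e).Holds s ↔ ¬ e.Holds s := by
  simp [Holds, eval_not]

theorem holds_add : (add a b).Holds s ↔ a.Holds s ∨ b.Holds s := by
  simp only [Holds, eval]
  omega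

open Classical in
theorem eval_and : (and a b).eval s = if a.Holds s ∧ b.Holds s then 1 else 0 := by
  simp only [and, eval_not, eval, Holds]
  split_ifs <;> simp_all

theorem holds_and : (and a b).Holds s ↔ a.Holds s ∧ b.Holds s := by
  simp [and, holds_not, holds_add]

theorem holds_lt : (lt a b).Holds s ↔ a.eval s < b.eval s := by
  simp only [Holds, lt, eval]
  omega

theorem holds_eq : (eq a b).Holds s ↔ a.eval s = b.eval s := by
  rw [eq, holds_not, Holds]
  simp only [eval]
  omega

theorem holds_sum : (sum x y e).Holds s ↔ ∃ v < s.reg y, e.Holds (s.setReg x v) := by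
  simp [Holds, eval, Finset.sum_eq_zero_iff]

/-- Universal quantification over the values of register `x` below that of register `y`. -/
def all (x y : ℕ) (e : SumExpr) : SumExpr := not (sum x y (not e))

theorem holds_sum_iff {N : ℕ} (h : s.reg y = N) :
    (sum x y e).Holds s ↔ ∃ v : Fin N, e.Holds (s.setReg x v) := by
  subst h
  rw [holds_sum]
  exact ⟨fun ⟨v, hv, he⟩ => ⟨⟨v, hv⟩, he⟩, fun ⟨v, he⟩ => ⟨v, v.2, he⟩⟩

theorem holds_all_iff {N : ℕ} (h : s.reg y = N) :
    (all x y e).Holds s ↔ ∀ v : Fin N, e.Holds (s.setReg x v) := by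
  rw [all, holds_not, holds_sum_iff h]
  simp [holds_not]

/-- The least value of register `13` below that of register `1` for which `e` holds. -/
def first (e : SumExpr) : SumExpr :=
  sum 12 1 (not (sum 13 1 (and (not (lt (reg 12) (reg 13))) e)))

/-- The outer sum counts the values `u` with no witness at or below `u`. Their number is the least
witness, or `m` if there is none, so comparing the result with `m` tells success from failure. -/
theorem eval_first {m : ℕ} (hm : s.reg 1 = m) {p : Fin m → Prop}
    (hp : ∀ (u : ℕ) (v : Fin m), e.Holds ((s.setReg 12 u).setReg 13 v) ↔ p v) :
    (∃ v, p v ∧ (first e).eval s = v) ∨ ((∀ v, ¬ p v) ∧ (first e).eval s = m) := by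
  classical
  have hval : (first e).eval s =
      ∑ u ∈ Finset.range m, if ∃ v : Fin m, (v : ℕ) ≤ u ∧ p v then 0 else 1 := by
    simp only [first, eval, hm]
    refine Finset.sum_congr rfl fun u _ => ?_
    rw [eval_not]
    have : (sum 13 1 (and (not (lt (reg 12) (reg 13))) e)).eval (s.setReg 12 u) = 0 ↔
        ¬ ∃ v : Fin m, (v : ℕ) ≤ u ∧ p v := by
      have h := holds_sum (x := 13) (y := 1) (e := and (not (lt (reg 12) (reg 13))) e)
        (s := s.setReg 12 u)
      rw [← not_iff_not, not_not, ← Ne, ← Holds, h]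
      simp only [State.setReg_reg, holds_and, holds_not, holds_lt, eval_reg]
      norm_num [hm]
      constructor
      · rintro ⟨v, hv, huv, he⟩
        exact ⟨⟨v, hv⟩, huv, (hp u ⟨v, hv⟩).1 he⟩
      · rintro ⟨v, huv, he⟩
        exact ⟨v, v.2, huv, (hp u v).2 he⟩
    by_cases hex : ∃ v : Fin m, (v : ℕ) ≤ u ∧ p v
    · rw [if_pos hex, if_neg (fun h0 => (this.1 h0) hex)]
    · rw [if_neg hex, if_pos (this.2 hex)]
  by_cases hex : ∃ v, p v
  · left
    obtain ⟨v, hv, hmin⟩ := WellFounded.has_min (wellFounded_lt (α := Fin m)) {v | p v} hex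
    refine ⟨v, hv, ?_⟩
    have : ∀ u ∈ Finset.range m, (if ∃ w : Fin m, (w : ℕ) ≤ u ∧ p w then 0 else 1) =
        if u < v then 1 else 0 := by
      intro u _
      by_cases huv : u < v
      · rw [if_pos huv, if_neg]
        rintro ⟨w, hw, hpw⟩
        exact hmin w hpw (Fin.lt_def.2 (by omega))
      · rw [if_neg huv, if_pos ⟨v, by omega, hv⟩]
    rw [hval, Finset.sum_congr rfl this, ← Finset.card_filter,
      show (Finset.range m).filter (fun u => u < (v : ℕ)) = Finset.range v by
        ext u; simp; omega, Finset.card_range]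
  · right
    push Not at hex
    refine ⟨hex, ?_⟩
    rw [hval, Finset.sum_congr rfl fun u _ => if_neg (by simp [hex])]
    simp

end SumExpr

/-! ### Memory layout and the expressions used by the program -/

open SumExpr

/-- The state holds the profile, the number `k`, and the order of removal `ord`. -/
structure Stores {n m : ℕ} (P : Profile (Fin n) (Fin m)) (k : ℕ) (ord : Fin m → ℕ) (s : State) :
    Prop where
  reg_zero : s.reg 0 = n
  reg_one : s.reg 1 = m
  reg_two : s.reg 2 = k
  pos : ∀ (i : Fin n) (a : Fin m), s.arr 0 i a = P.pos i a
  ord : ∀ a : Fin m, s.arr 2 a 0 = ord a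

section

variable {n m : ℕ} {P : Profile (Fin n) (Fin m)} {k : ℕ} {ord : Fin m → ℕ} {s : State}

theorem Stores.setReg (h : Stores P k ord s) {x : ℕ} (hx : 3 ≤ x) (v : ℕ) :
    Stores P k ord (s.setReg x v) := by
  refine ⟨?_, ?_, ?_, h.pos, h.ord⟩ <;> rw [State.setReg_reg, if_neg (by omega)]
  exacts [h.reg_zero, h.reg_one, h.reg_two]

theorem Stores.setArr (h : Stores P k ord s) {A : ℕ} (hA : A ≠ 0) (hA2 : A ≠ 2) (i j v : ℕ) :
    Stores P k ord (s.setArr A i j v) :=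
  ⟨h.reg_zero, h.reg_one, h.reg_two,
    fun i a => by rw [State.setArr_arr, if_neg (by omega), h.pos],
    fun a => by rw [State.setArr_arr, if_neg (by omega), h.ord]⟩

/-- Entry `x` of the one-dimensional array `A`. -/
def entry (A x : ℕ) : SumExpr := cell A (reg x) (const 0)

theorem eval_entry {A x : ℕ} : (entry A x).eval s = s.arr A (s.reg x) 0 := rfl

theorem holds_entry {A x : ℕ} : (entry A x).Holds s ↔ s.arr A (s.reg x) 0 ≠ 0 := Iff.rfl

/-- `a` is ranked last among the remaining candidates by some voter. -/
def bottomExpr (a : ℕ) : SumExpr :=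
  and (not (entry 2 a)) (sum 10 0 (all 11 1 (add (entry 2 11)
    (add (eq (reg 11) (reg a)) (lt (cell 0 (reg 10) (reg 11)) (cell 0 (reg 10) (reg a)))))))

/-- `b` belongs to the attachment set of `a` at the time when `a` is removed. -/
def attachExpr (a b : ℕ) : SumExpr :=
  and (not (lt (entry 2 a) (entry 2 b))) (and (not (eq (reg b) (reg a)))
    (all 10 0 (add (lt (cell 0 (reg 10) (reg b)) (cell 0 (reg 10) (reg a)))
      (all 11 1 (add (lt (entry 2 a) (entry 2 11)) (add (eq (reg 11) (reg a))
        (add (eq (reg 11) (reg b))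
          (lt (cell 0 (reg 10) (reg b)) (cell 0 (reg 10) (reg 11))))))))))

/-- The number of removed candidates that are attached to `b`. -/
def loadExpr (b : ℕ) : SumExpr := sum 15 1 (and (entry 2 15) (eq (entry 3 15) (reg b)))

/-- The bound on the number of candidates that may be attached to `b`. -/
def capacityExpr (b : ℕ) : SumExpr := sub (reg 2) (not (not (entry 2 b)))

theorem Stores.holds_bottomExpr (h : Stores P k ord s) {x : ℕ} (hx : x ≠ 10 ∧ x ≠ 11)
    {a : Fin m} (ha : s.reg x = a) :
    (bottomExpr x).Holds s ↔ ord a = 0 ∧ a ∈ P.bottoms (remaining ord 0) := by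
  have hall : ∀ i : Fin n, (all 11 1 (add (entry 2 11) (add (eq (reg 11) (reg x))
      (lt (cell 0 (reg 10) (reg 11)) (cell 0 (reg 10) (reg x)))))).Holds (s.setReg 10 i) ↔
      ∀ c : Fin m, ord c ≠ 0 ∨ c = a ∨ P.prefers i c a := by
    intro i
    rw [holds_all_iff (h.setReg (by omega) _).reg_one]
    refine forall_congr' fun c => ?_
    simp [holds_add, holds_entry, holds_eq, holds_lt, eval_cell, eval_reg, hx.1,
      hx.2, ha, h.ord, h.pos, P.pos_lt_pos_iff, Fin.val_inj]
  have hor : ∀ i : Fin n, (∀ c : Fin m, ord c ≠ 0 ∨ c = a ∨ P.prefers i c a) ↔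
      ∀ c : Fin m, ord c = 0 → c ≠ a → P.prefers i c a := fun i => forall_congr' fun c => by tauto
  rw [bottomExpr, holds_and, holds_not, holds_sum_iff h.reg_zero]
  simp only [hall, holds_entry, ha, h.ord, Profile.mem_bottoms,
    mem_remaining, not_not, Nat.le_zero, hor]
  tauto

theorem Stores.holds_attachExpr (h : Stores P k ord s) (hn : 1 ≤ n) {x y : ℕ}
    (hx : x ≠ 10 ∧ x ≠ 11) (hy : y ≠ 10 ∧ y ≠ 11) {a b : Fin m} (ha : s.reg x = a)
    (hb : s.reg y = b) :
    (attachExpr x y).Holds s ↔ b ∈ P.attachSet (remaining ord (ord a)) a := by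
  have : Nonempty (Fin n) := ⟨⟨0, hn⟩⟩
  have hall : ∀ i : Fin n, (all 11 1 (add (lt (entry 2 x) (entry 2 11)) (add (eq (reg 11) (reg x))
        (add (eq (reg 11) (reg y)) (lt (cell 0 (reg 10) (reg y))
          (cell 0 (reg 10) (reg 11))))))).Holds (s.setReg 10 i) ↔
      ∀ c : Fin m, ord a < ord c ∨ c = a ∨ c = b ∨ P.prefers i b c := by
    intro i
    rw [holds_all_iff (h.setReg (by omega) _).reg_one]
    refine forall_congr' fun c => ?_
    simp [holds_add, eval_entry, holds_eq, holds_lt, eval_cell, eval_reg, hx.1,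
      hx.2, hy.1, hy.2, ha, hb, h.ord, h.pos, P.pos_lt_pos_iff, Fin.val_inj]
  have hpos : ∀ i : Fin n, (lt (cell 0 (reg 10) (reg y)) (cell 0 (reg 10) (reg x))).Holds
      (s.setReg 10 i) ↔ P.prefers i b a := by
    intro i
    simp [holds_lt, eval_cell, eval_reg, hx.1, hy.1, ha, hb, h.pos, P.pos_lt_pos_iff]
  rw [Profile.mem_attachSet (mem_remaining.2 le_rfl), attachExpr, holds_and, holds_and, holds_not,
    holds_not, holds_all_iff h.reg_zero]
  simp only [holds_add, hall, hpos, holds_lt, holds_eq, eval_entry, eval_reg, ha, hb,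
    h.ord, not_lt, mem_remaining, Fin.val_inj]
  grind

theorem Stores.eval_loadExpr (h : Stores P k ord s) {x : ℕ} (hx : x ≠ 15) {b : Fin m}
    (hb : s.reg x = b) {t : Fin m} (ht : ∀ a, ord a = 0 ↔ a = t) {F : Fin m → Fin m}
    (hF : ∀ a : Fin m, s.arr 3 a 0 = F a) : (loadExpr x).eval s = loadOff t F b := by
  rw [loadExpr, eval, h.reg_one, Finset.sum_range, loadOff, Finset.card_filter]
  refine Finset.sum_congr rfl fun a _ => ?_
  rw [eval_and]
  simp [holds_eq, holds_entry, eval_entry, eval_reg, hx, hb, h.ord, hF, ht,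
    Fin.val_inj]

/-- The double negation turns the removal time into `0` or `1`, and only the sink has time `0`. -/
theorem Stores.eval_capacityExpr (h : Stores P k ord s) {x : ℕ} {b : Fin m}
    (hb : s.reg x = b) {t : Fin m} (ht : ∀ a, ord a = 0 ↔ a = t) :
    (capacityExpr x).eval s = capacity t k b := by
  simp only [capacityExpr, eval, eval_not, eval_entry, hb, h.ord, h.reg_two, capacity, ht]
  split_ifs <;> simp_all

end

theorem Block.run_ite_pos {e : SumExpr} {b c : Block} {s : State} (h : e.Holds s) :
    (Block.ite e b c).run s = b.run s := if_pos h

theorem Block.run_ite_neg {e : SumExpr} {b c : Block} {s : State} (h : ¬ e.Holds s) :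
    (Block.ite e b c).run s = c.run s := if_neg h

/-! ### Removing the candidates -/

/-- Remove one candidate that some voter ranks last, or report a failure. -/
def removalStep : Block :=
  -- Registers `5` and `6` receive the removed candidate and its target, `9` the number of
  -- candidates left before the removal. Register `3` keeps the loop running and `4` flags a
  -- failure; arrays `2`, `3`, `4` hold removal times, targets and, later, labels.
  .seq (.assign 5 (first (bottomExpr 13)))
  (.seq (.assign 6 (first (attachExpr 5 13)))
  (.seq (.assign 9 (sum 15 1 (not (entry 2 15))))
  (.ite (lt (reg 6) (reg 1))
    (.seq (.store 3 (reg 5) (const 0) (reg 6))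
      -- The loop goes on if more than two candidates were left, that is, at least two after this
      -- removal.
      (.seq (.store 2 (reg 5) (const 0) (reg 9)) (.assign 3 (lt (const 2) (reg 9)))))
    (.seq (.assign 4 (const 1)) (.assign 3 (const 0))))))

theorem removalStep_valid : removalStep.Valid := by
  simp [removalStep, Block.Valid, SumExpr.Valid, first, bottomExpr, attachExpr, entry, SumExpr.not,
    SumExpr.and, SumExpr.lt, SumExpr.eq, all]

variable {n m : ℕ}

/-- The candidates are removed in the order `ord`, and each is attached to the candidate that is
given by `F`. -/
structure IsPartialAttachment (P : Profile (Fin n) (Fin m)) (ord : Fin m → ℕ) (F : Fin m → Fin m) :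
    Prop where
  isRemovalOrder : IsRemovalOrder P ord
  arc : ∀ a, ord a ≠ 0 → (removalDigraph P ord).Adj a (F a)
  -- The number of remaining candidates is thus a fresh time below all earlier ones.
  card_lt : ∀ a, ord a ≠ 0 → (remaining ord 0).card < ord a
  nonempty : (remaining ord 0).Nonempty

theorem IsPartialAttachment.update {P : Profile (Fin n) (Fin m)} {ord : Fin m → ℕ}
    {F : Fin m → Fin m} (h : IsPartialAttachment P ord F) {a b : Fin m} (ha0 : ord a = 0)
    (ha : a ∈ P.bottoms (remaining ord 0)) (hb : b ∈ P.attachSet (remaining ord 0) a)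
    (hcard : 2 ≤ (remaining ord 0).card) :
    (remaining (Function.update ord a (remaining ord 0).card) 0).card =
        (remaining ord 0).card - 1 ∧
      IsPartialAttachment P (Function.update ord a (remaining ord 0).card)
        (Function.update F a b) := by
  obtain ⟨hadj, hadj', hord⟩ := h.isRemovalOrder.update (v := (remaining ord 0).card) (by omega)
    h.card_lt ha0 ha ⟨b, hb⟩
  have hrem : remaining (Function.update ord a (remaining ord 0).card) 0 =
      (remaining ord 0).erase a := by
    ext c
    rw [Finset.mem_erase, mem_remaining, mem_remaining, Function.update_apply]
    split_ifs with hca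
    · simp only [hca, ne_eq, not_true, false_and, iff_false]
      omega
    · simp [hca]
  have hcard' : (remaining (Function.update ord a (remaining ord 0).card) 0).card =
      (remaining ord 0).card - 1 := by
    rw [hrem, Finset.card_erase_of_mem (mem_remaining.2 ha0.le)]
  refine ⟨hcard', hord, fun c hc => ?_, fun c hc => ?_, Finset.card_pos.1 (by omega)⟩
  · by_cases hca : c = a
    · subst hca
      rwa [Function.update_self, hadj]
    · rw [Function.update_of_ne hca] at hc ⊢
      rw [hadj' c hca]
      exact h.arc c hc
  · rw [hcard']
    by_cases hca : c = a
    · subst hca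
      rw [Function.update_self]
      omega
    · rw [Function.update_of_ne hca] at hc ⊢
      have := h.card_lt c hc
      omega

/-- The invariant of the first loop. -/
def RemovalInvariant (P : Profile (Fin n) (Fin m)) (k μ : ℕ) (s : State) : Prop :=
  ∃ (ord : Fin m → ℕ) (F : Fin m → Fin m), Stores P k ord s ∧ IsPartialAttachment P ord F ∧
    (∀ a : Fin m, s.arr 3 a 0 = F a) ∧ (∀ i j, s.arr 1 i j = 0) ∧ (∀ i, s.arr 4 i 0 = 0) ∧
    (s.reg 3 ≠ 0 → 2 ≤ (remaining ord 0).card ∧ (remaining ord 0).card ≤ μ) ∧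
    (s.reg 3 = 0 → s.reg 4 = 0 → (remaining ord 0).card ≤ 1) ∧
    (s.reg 4 ≠ 0 → ¬ P.trees.Nonempty)

theorem RemovalInvariant.step {P : Profile (Fin n) (Fin m)} {k μ : ℕ} {s : State} (hn : 1 ≤ n)
    (h : RemovalInvariant P k μ s) (h3 : s.reg 3 ≠ 0) :
    ∃ μ' < μ, RemovalInvariant P k μ' (removalStep.run s) := by
  obtain ⟨ord, F, hs, hF, hsF, h1, h4, hμ, -, hfail⟩ := h
  obtain ⟨hcard, hμ⟩ := hμ h3
  have : Nonempty (Fin n) := ⟨⟨0, hn⟩⟩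
  obtain ⟨a, ha0, hab, ha⟩ : ∃ a : Fin m, ord a = 0 ∧ a ∈ P.bottoms (remaining ord 0) ∧
      (first (bottomExpr 13)).eval s = a := by
    rcases eval_first hs.reg_one fun u (v : Fin m) =>
      ((hs.setReg (x := 12) (by omega) u).setReg (x := 13) (by omega) v).holds_bottomExpr
        (x := 13) (by omega) (a := v) (by simp) with ⟨a, ha, hv⟩ | ⟨hno, -⟩
    · exact ⟨a, ha.1, ha.2, hv⟩
    · obtain ⟨a, ha⟩ := P.exists_isBottom (⟨0, hn⟩ : Fin n) hF.nonempty
      exact absurd ⟨by simpa [mem_remaining] using ha.1,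
        Profile.mem_bottoms.2 ⟨ha.1, ⟨0, hn⟩, ha.2⟩⟩ (hno a)
  have hs₁ := hs.setReg (x := 5) (by omega) a
  have h6 := eval_first (e := attachExpr 5 13) hs₁.reg_one fun u (v : Fin m) =>
    ((hs₁.setReg (x := 12) (by omega) u).setReg (x := 13) (by omega) v).holds_attachExpr hn
      (x := 5) (y := 13) (by omega) (by omega) (a := a) (b := v) (by simp) (by simp)
  rw [ha0] at h6
  set w := (first (attachExpr 5 13)).eval (s.setReg 5 a) with hw
  have hs₂ := hs₁.setReg (x := 6) (by omega) w
  have h9 : (sum 15 1 (not (entry 2 15))).eval ((s.setReg 5 a).setReg 6 w) =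
      (remaining ord 0).card := by
    rw [SumExpr.eval, hs₂.reg_one, Finset.sum_range, remaining, Finset.card_filter]
    refine Finset.sum_congr rfl fun c _ => ?_
    rw [eval_not]
    simp [eval_entry, hs.ord]
  have hs₃ := hs₂.setReg (x := 9) (by omega) (remaining ord 0).card
  simp only [removalStep, Block.run.eq_3, Block.run.eq_1, ha, ← hw, h9]
  rcases h6 with ⟨b, hb, hwb⟩ | ⟨hno, hwm⟩
  · rw [Block.run_ite_pos (by
      simp only [holds_lt, eval_reg, hs₃.reg_one]
      simp [hwb])]
    obtain ⟨hcard', hF'⟩ := hF.update ha0 hab hb hcard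
    refine ⟨μ - 1, by omega, _, _, ⟨hs.reg_zero, hs.reg_one, hs.reg_two, ?_, ?_⟩, hF', ?_, ?_, ?_,
      ?_, ?_, ?_⟩ <;> simp only [Block.run, eval_reg, eval_const, State.setReg_reg,
        State.setReg_arr, State.setArr_reg, State.setArr_arr]
    · intro i c
      simp [hs.pos]
    · intro c
      simp [Fin.val_inj, Function.update_apply, hs.ord]
    · intro c
      simp only [Function.update_apply]
      split_ifs <;> simp_all [Fin.val_inj]
    · simp [h1]
    · simp [h4]
    · intro h3'
      simp [SumExpr.lt, SumExpr.eval] at h3'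
      omega
    · intro h3'
      simp [SumExpr.lt, SumExpr.eval] at h3'
      omega
    · simpa using hfail
  · rw [Block.run_ite_neg (by
      simp only [holds_lt, eval_reg, hs₃.reg_one]
      simp [hwm])]
    -- Register `3` is cleared, so the bound by the loop index becomes vacuous and `0` will do.
    refine ⟨0, by omega, ord, F, (hs₃.setReg (by omega) _).setReg (by omega) _, hF, ?_⟩
    have hempty : P.attachSet (remaining ord 0) a = ∅ :=
      Finset.eq_empty_of_forall_notMem hno
    obtain ⟨c, hc, hca⟩ := Finset.exists_mem_ne (by omega : 1 < (remaining ord 0).card) a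
    have := hF.isRemovalOrder.trees_eq_empty hab (by simpa [mem_remaining] using hc) hca hempty
    simp [Block.run, eval_const, hsF, h1, h4, this]

/-! ### Balancing the loads -/

/-- Push along an arc out of an overloaded candidate, or relabel it; stop if there is none, and
report a failure if its label cannot be raised. -/
def pushStep : Block :=
  .seq (.assign 6 (first (lt (capacityExpr 13) (loadExpr 13))))
  (.ite (lt (reg 6) (reg 1))
    -- The search is for a candidate attached to the overloaded one in register `6` that has an arc
    -- to a label exactly one lower; register `7` then finds the head of such an arc.
    (.seq (.assign 5 (first (and (entry 2 13) (and (eq (entry 3 13) (reg 6))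
        (sum 14 1 (and (attachExpr 13 14) (eq (entry 4 6) (add (entry 4 14) (const 1)))))))))
      (.ite (lt (reg 5) (reg 1))
        (.seq (.assign 7 (first (and (attachExpr 5 13)
            (eq (entry 4 6) (add (entry 4 13) (const 1))))))
          (.store 3 (reg 5) (const 0) (reg 7)))
        (.ite (lt (entry 4 6) (reg 1))
          (.store 4 (reg 6) (const 0) (add (entry 4 6) (const 1)))
          (.seq (.assign 4 (const 1)) (.assign 3 (const 0))))))
    (.assign 3 (const 0)))

theorem pushStep_valid : pushStep.Valid := by
  simp [pushStep, Block.Valid, SumExpr.Valid, first, loadExpr, capacityExpr, attachExpr, entry,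
    SumExpr.not, SumExpr.and, SumExpr.lt, SumExpr.eq, all]

/-- The invariant of the second loop. -/
def PushInvariant (P : Profile (Fin n) (Fin m)) (k μ : ℕ) (s : State) : Prop :=
  ∃ ord : Fin m → ℕ, Stores P k ord s ∧ (∀ i j, s.arr 1 i j = 0) ∧
    ((s.reg 4 ≠ 0 ∧ s.reg 3 = 0 ∧ ¬ (P.treesMaxDegree k).Nonempty) ∨
      (s.reg 4 = 0 ∧ ∃ (t : Fin m) (F : Fin m → Fin m) (d : Fin m → ℕ),
        OrientsTrees P (removalDigraph P ord) t ∧ (∀ a, ord a = 0 ↔ a = t) ∧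
        (∀ a : Fin m, s.arr 3 a 0 = F a) ∧ (∀ a : Fin m, s.arr 4 a 0 = d a) ∧
        IsValidLabelling (removalDigraph P ord) t (capacity t k) F d ∧
        (s.reg 3 ≠ 0 → labelPotential t F d < μ) ∧
        (s.reg 3 = 0 → ∀ b, loadOff t F b ≤ capacity t k b)))

theorem PushInvariant.step {P : Profile (Fin n) (Fin m)} {k μ : ℕ} {s : State} (hn : 1 ≤ n)
    (hk : 1 ≤ k) (h : PushInvariant P k μ s) (h3 : s.reg 3 ≠ 0) :
    ∃ μ' < μ, PushInvariant P k μ' (pushStep.run s) := by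
  obtain ⟨ord, hs, h1, ⟨-, h3', -⟩ | ⟨h4, t, F, d, hD, ht, hF, hd, hlab, hμ, -⟩⟩ := h
  · exact absurd h3' h3
  have hμ := hμ h3
  have h6 := eval_first (e := lt (capacityExpr 13) (loadExpr 13)) hs.reg_one
    (p := fun v => capacity t k v < loadOff t F v) fun u (v : Fin m) => by
      have hs' := (hs.setReg (x := 12) (by omega) u).setReg (x := 13) (by omega) v
      rw [holds_lt, hs'.eval_capacityExpr (x := 13) (b := v) (by simp) ht,
        hs'.eval_loadExpr (x := 13) (by omega) (b := v) (by simp) ht (F := F) (by simpa using hF)]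
  set w := (first (lt (capacityExpr 13) (loadExpr 13))).eval s with hw
  have hs₁ := hs.setReg (x := 6) (by omega) w
  simp only [pushStep, Block.run.eq_3, Block.run.eq_1, ← hw]
  rcases h6 with ⟨b, hb, hwb⟩ | ⟨hno, hwm⟩
  swap
  · rw [Block.run_ite_neg (by
      simp only [holds_lt, eval_reg, hs₁.reg_one]
      simp [hwm])]
    refine ⟨0, by omega, ord, hs₁.setReg (by omega) _, h1, .inr ⟨by simpa [Block.run] using h4,
      t, F, d, hD, ht, hF, hd, hlab, by simp [Block.run, eval_const], fun _ b => not_lt.1 (hno b)⟩⟩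
  rw [Block.run_ite_pos (by
    simp only [holds_lt, eval_reg, hs₁.reg_one]
    simp [hwb])]
  rw [hwb] at hs₁ ⊢
  have h5 := eval_first (e := and (entry 2 13) (and (eq (entry 3 13) (reg 6))
      (sum 14 1 (and (attachExpr 13 14) (eq (entry 4 6) (add (entry 4 14) (const 1)))))))
    hs₁.reg_one (p := fun a => a ≠ t ∧ F a = b ∧ ∃ c, (removalDigraph P ord).Adj a c ∧
      d b = d c + 1) fun u (v : Fin m) => by
      have hs' := (hs₁.setReg (x := 12) (by omega) u).setReg (x := 13) (by omega) v
      have hsum : ∀ c : Fin m, (and (attachExpr 13 14)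
          (eq (entry 4 6) (add (entry 4 14) (const 1)))).Holds
          ((((s.setReg 6 b).setReg 12 u).setReg 13 v).setReg 14 c) ↔
          c ∈ P.attachSet (remaining ord (ord v)) v ∧ d b = d c + 1 := by
        intro c
        rw [holds_and, (hs'.setReg (x := 14) (by omega) c).holds_attachExpr hn (x := 13) (y := 14)
          (by omega) (by omega) (a := v) (b := c) (by simp) (by simp), holds_eq]
        simp [SumExpr.eval, eval_entry, hd]
      rw [holds_and, holds_and, holds_sum_iff hs'.reg_one]
      simp only [hsum, holds_eq, holds_entry, eval_entry, eval_reg]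
      simp only [State.setReg_reg, State.setReg_arr, if_true, hs.ord, hF, ← ht, removalDigraph,
        ne_eq]
      simp [Fin.val_inj]
      tauto
  set x := (first (and (entry 2 13) (and (eq (entry 3 13) (reg 6)) (sum 14 1
    (and (attachExpr 13 14) (eq (entry 4 6) (add (entry 4 14) (const 1)))))))).eval
      (s.setReg 6 b) with hx
  have hs₂ := hs₁.setReg (x := 5) (by omega) x
  simp only [Block.run.eq_3, Block.run.eq_1, ← hx]
  rcases h5 with ⟨a, ⟨hat, hFa, c₀, hc₀, hdc₀⟩, hxa⟩ | ⟨hno, hxm⟩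
  · rw [Block.run_ite_pos (by
      simp only [holds_lt, eval_reg, hs₂.reg_one]
      simp [hxa])]
    rw [hxa] at hs₂ ⊢
    have h7 := eval_first (e := and (attachExpr 5 13) (eq (entry 4 6) (add (entry 4 13) (const 1))))
      hs₂.reg_one (p := fun c => c ∈ P.attachSet (remaining ord (ord a)) a ∧ d b = d c + 1)
      fun u (v : Fin m) => by
        have hs' := (hs₂.setReg (x := 12) (by omega) u).setReg (x := 13) (by omega) v
        rw [holds_and, hs'.holds_attachExpr hn (x := 5) (y := 13) (by omega) (by omega) (a := a)
          (b := v) (by simp) (by simp), holds_eq]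
        simp [SumExpr.eval, eval_entry, hd]
    obtain ⟨c, ⟨hc, hdc⟩, hv⟩ := h7.resolve_right fun h => h.1 c₀ ⟨hc₀.2, hdc₀⟩
    have hac : (removalDigraph P ord).Adj a c := ⟨hc₀.1, hc⟩
    obtain ⟨hlab', hpot⟩ := hlab.push hat (by rwa [hFa]) hac (by rwa [hFa])
    refine ⟨labelPotential t F d, hμ, ord, ?_, ?_, .inr ⟨?_, t, Function.update F a c, d, hD, ht,
      ?_, ?_, hlab', fun _ => hpot, ?_⟩⟩ <;> simp only [Block.run.eq_3, Block.run.eq_1, hv]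
    · exact (hs₂.setReg (x := 7) (by omega) _).setArr (by omega) (by omega) _ _ _
    · simp [Block.run, State.setArr_arr, h1]
    · simpa [Block.run] using h4
    · intro e
      by_cases hea : e = a <;>
        simp [Block.run, State.setArr_arr, eval_reg, eval_const, hF, hea, Fin.val_inj]
    · simp [Block.run, State.setArr_arr, hd]
    · intro h3'
      exact absurd (by simpa [Block.run] using h3') h3
  · rw [Block.run_ite_neg (by
      simp only [holds_lt, eval_reg, hs₂.reg_one]
      simp [hxm])]
    have hlt : (lt (entry 4 6) (reg 1)).Holds ((s.setReg 6 b).setReg 5 x) ↔ d b < m := by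
      rw [holds_lt, eval_reg, hs₂.reg_one]
      simp [eval_entry, hd]
    by_cases hdb : d b < m
    · rw [Block.run_ite_pos (hlt.2 hdb)]
      obtain ⟨hlab', hpot⟩ := hlab.relabel hb (by simpa using hdb)
        fun a hat hFa c hac hdc => hno a ⟨hat, hFa, c, hac, hdc⟩
      refine ⟨labelPotential t F d, hμ, ord, hs₂.setArr (by omega) (by omega) _ _ _, ?_,
        .inr ⟨?_, t, F, Function.update d b (d b + 1), hD, ht, ?_, ?_, hlab', fun _ => hpot, ?_⟩⟩
      · simp [Block.run, State.setArr_arr, h1]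
      · simpa [Block.run] using h4
      · simp [Block.run, State.setArr_arr, hF]
      · intro e
        by_cases heb : e = b <;>
          simp [Block.run, State.setArr_arr, SumExpr.eval, eval_entry, hd, heb, Fin.val_inj]
      · intro h3'
        exact absurd (by simpa [Block.run] using h3') h3
    · rw [Block.run_ite_neg (fun h => hdb (hlt.1 h))]
      refine ⟨0, by omega, ord, (hs₂.setReg (by omega) _).setReg (by omega) _, h1,
        .inl ⟨by simp [Block.run, eval_const], by simp [Block.run, eval_const], ?_⟩⟩
      exact hlab.treesMaxDegree_eq_empty hk hD hb (by simpa using not_lt.1 hdb)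

/-- All labels are still `0`, so the potential equals `(m + 1) * (m * m)`, and the index must exceed
it by one. Register `3` starts the second loop only if the removal did not fail. -/
theorem RemovalInvariant.pushInvariant {P : Profile (Fin n) (Fin m)} {k μ : ℕ} {s : State}
    (hn : 1 ≤ n) (h : RemovalInvariant P k μ s) (h3 : s.reg 3 = 0) :
    PushInvariant P k ((m + 1) * (m * m) + 1) (s.setReg 3 ((not (reg 4)).eval s)) := by
  obtain ⟨ord, F, hs, hF, hsF, h1, hd, -, hdone, hfail⟩ := h
  have : Nonempty (Fin n) := ⟨⟨0, hn⟩⟩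
  refine ⟨ord, hs.setReg (by omega) _, h1, ?_⟩
  simp only [eval_not, eval_reg, State.setReg_reg, State.setReg_arr, if_true]
  by_cases h4 : s.reg 4 = 0
  · have hcard := hdone h3 h4
    obtain ⟨t, ht⟩ := hF.nonempty
    have ht0 : ord t = 0 := by simpa [mem_remaining] using ht
    have ht' : ∀ a, ord a = 0 ↔ a = t := fun a =>
      ⟨fun ha => Finset.card_le_one.1 hcard a (mem_remaining.2 ha.le) t ht, fun ha => ha ▸ ht0⟩
    refine .inr ⟨by simp [h4], t, F, fun _ => 0, hF.isRemovalOrder.orientsTrees ht0 hcard, ht', hsF,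
      fun a => hd a, ⟨fun a ha => hF.arc a fun h => ha ((ht' a).1 h), by simp, by simp, by simp⟩,
      fun _ => by simp [labelPotential], by simp [h4]⟩
  · exact .inl ⟨by simp [h4], by simp [h4], fun ⟨T, hT⟩ => hfail h4 ⟨T, hT.1⟩⟩

/-! ### Writing the adjacency matrix -/

/-- Write the edge from the candidate in register `5` to the candidate that it is attached to. -/
def outputStep : Block :=
  .seq (.ite (entry 2 5)
    (.seq (.store 1 (reg 5) (entry 3 5) (const 1)) (.store 1 (entry 3 5) (reg 5) (const 1)))
    -- The sink contributes no edge; register `6` is free by now, and this write serves as an empty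
    -- branch.
    (.assign 6 (const 0)))
  (.seq (.assign 5 (add (reg 5) (const 1))) (.assign 3 (lt (reg 5) (reg 1))))

theorem outputStep_valid : outputStep.Valid := by
  simp [outputStep, Block.Valid, SumExpr.Valid, entry, SumExpr.lt]

open Classical in
/-- The invariant of the third loop. -/
def OutputInvariant (P : Profile (Fin n) (Fin m)) (k μ : ℕ) (s : State) : Prop :=
  (s.reg 4 ≠ 0 ∧ s.reg 3 = 0 ∧ ¬ (P.treesMaxDegree k).Nonempty) ∨
    (s.reg 4 = 0 ∧ ∃ (ord : Fin m → ℕ) (t : Fin m) (F : Fin m → Fin m) (T : SimpleGraph (Fin m)),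
      Stores P k ord s ∧ (∀ a, ord a = 0 ↔ a = t) ∧ (∀ a : Fin m, s.arr 3 a 0 = F a) ∧
      T ∈ P.treesMaxDegree k ∧ (∀ a b, T.Adj a b ↔ a ≠ t ∧ F a = b ∨ b ≠ t ∧ F b = a) ∧
      (∀ a b : Fin m, s.arr 1 a b = if a < s.reg 5 ∧ a ≠ t ∧ F a = b ∨
        b < s.reg 5 ∧ b ≠ t ∧ F b = a then 1 else 0) ∧
      (s.reg 3 ≠ 0 → s.reg 5 < m ∧ m ≤ s.reg 5 + μ) ∧ (s.reg 3 = 0 → m ≤ s.reg 5))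

theorem PushInvariant.outputInvariant {P : Profile (Fin n) (Fin m)} {k μ : ℕ} {s : State}
    (hk : 1 ≤ k) (hm : 1 ≤ m) (h : PushInvariant P k μ s) (h3 : s.reg 3 = 0) :
    OutputInvariant P k m ((s.setReg 5 0).setReg 3 ((not (reg 4)).eval (s.setReg 5 0))) := by
  obtain ⟨ord, hs, h1, ⟨h4, -, hemp⟩ | ⟨h4, t, F, d, hD, ht, hF, -, hlab, -, hle⟩⟩ := h
  · exact .inl ⟨by simpa using h4, by simp [eval_not, eval_reg, h4], hemp⟩
  · refine .inr ⟨by simpa using h4, ord, t, F, _, (hs.setReg (by omega) _).setReg (by omega) _, ht,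
      hF, hlab.mem_treesMaxDegree hk hD (hle h3), fun a b => ?_, by simp [h1], ?_, ?_⟩
    · rw [treeOf_adj hD.asymm (fun a => hlab.arc a a.2)]
      simp
    · simp
      omega
    · simp [eval_not, eval_reg, h4]

theorem OutputInvariant.step {P : Profile (Fin n) (Fin m)} {k μ : ℕ} {s : State}
    (h : OutputInvariant P k μ s) (h3 : s.reg 3 ≠ 0) :
    ∃ μ' < μ, OutputInvariant P k μ' (outputStep.run s) := by
  classical
  obtain ⟨-, h3', -⟩ | ⟨h4, ord, t, F, T, hs, ht, hF, hT, hadj, h1, h5, -⟩ := h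
  · exact absurd h3' h3
  obtain ⟨h5m, hμ⟩ := h5 h3
  obtain ⟨c, hc⟩ : ∃ c : Fin m, s.reg 5 = c := ⟨⟨s.reg 5, h5m⟩, rfl⟩
  have hlt : ∀ a : Fin m, (a : ℕ) < c + 1 ↔ (a : ℕ) < c ∨ a = c := fun a => by
    rw [← Fin.val_inj]; omega
  refine ⟨μ - 1, by omega, .inr ?_⟩
  have hent : (entry 2 5).Holds s ↔ c ≠ t := by
    rw [holds_entry, hc, hs.ord, ne_eq, ht]
  have hrun : ∃ s', outputStep.run s = ((s'.setReg 5 (s'.reg 5 + 1)).setReg 3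
        ((lt (reg 5) (reg 1)).eval (s'.setReg 5 (s'.reg 5 + 1)))) ∧ Stores P k ord s' ∧
      (∀ a : Fin m, s'.arr 3 a 0 = F a) ∧ s'.reg 4 = 0 ∧ s'.reg 5 = c ∧
      ∀ a b : Fin m, s'.arr 1 a b = if a < (c : ℕ) + 1 ∧ a ≠ t ∧ F a = b ∨
        b < (c : ℕ) + 1 ∧ b ≠ t ∧ F b = a then 1 else 0 := by
    refine ⟨_, rfl, ?_⟩
    by_cases hct : c = t
    · rw [Block.run_ite_neg (fun h => hent.1 h hct)]
      refine ⟨hs.setReg (by omega) _, hF, by simpa [Block.run] using h4,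
        by simpa [Block.run] using hc, fun a b => ?_⟩
      simp only [Block.run, State.setReg_arr, h1, hc, hlt]
      congr 1
      grind
    · rw [Block.run_ite_pos (hent.2 hct)]
      refine ⟨(hs.setArr (by omega) (by omega) _ _ _).setArr (by omega) (by omega) _ _ _, ?_, h4,
        hc, fun a b => ?_⟩
      · simp [Block.run, State.setArr_arr, hF]
      · simp only [Block.run, State.setArr_arr, eval_reg, eval_entry, eval_const, State.setArr_reg,
          hc, hF, h1, hlt, Fin.val_inj, true_and]
        simp only [show (3 : ℕ) ≠ 1 by omega, false_and, if_false, Fin.val_inj]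
        grind
  obtain ⟨s', hrun, hs', hF', h4', h5', h1'⟩ := hrun
  rw [hrun]
  refine ⟨by simpa using h4', ord, t, F, T, (hs'.setReg (by omega) _).setReg (by omega) _, ht, hF',
    hT, hadj, fun a b => ?_, ?_, ?_⟩
  · simp [h5', h1']
  · simp [SumExpr.lt, SumExpr.eval, h5', hs'.reg_one]
    omega
  · simp [SumExpr.lt, SumExpr.eval, h5', hs'.reg_one]
    omega

/-! ### The program -/

/-- The program for the random access machine. -/
def degreeProgram : Program :=
  .seq (Block.assign 3 (lt (const 1) (reg 1))).compile
  (.seq (.loop (.reg 3) removalStep.compile)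
  (.seq (Block.assign 3 (not (reg 4))).compile
  (.seq (.loop (.reg 3) pushStep.compile)
  (.seq (Block.seq (.assign 5 (const 0)) (.assign 3 (not (reg 4)))).compile
  (.seq (.loop (.reg 3) outputStep.compile)
  -- A plain assignment, because valid blocks never write to register `0`, which bounds the sums
  -- over voters.
  (.assign 0 (.sub (.const 1) (.reg 4))))))))

open Polynomial in
/-- A bound on the running time of `degreeProgram` in terms of `|N| + |C|`. -/
noncomputable def degreeProgramCost : Polynomial ℕ :=
  (Block.assign 3 (lt (const 1) (reg 1))).cost + (X + 1) * (removalStep.cost + 2) +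
    (Block.assign 3 (not (reg 4))).cost + ((X + 1) * (X * X) + 2) * (pushStep.cost + 2) +
    (Block.seq (.assign 5 (const 0)) (.assign 3 (not (reg 4)))).cost +
    -- The `10` pays for six compositions and the four steps of the last assignment.
    (X + 1) * (outputStep.cost + 2) + 10

theorem removalInvariant_inputState (P : Profile (Fin n) (Fin m)) (k : ℕ) (hm : 1 ≤ m) :
    RemovalInvariant P k m
      ((Block.assign 3 (lt (const 1) (reg 1))).run (inputState P k)) := by
  have hrem : remaining (fun _ : Fin m => 0) 0 = Finset.univ := by ext; simp [mem_remaining]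
  refine ⟨fun _ => 0, fun _ => ⟨0, hm⟩, ⟨rfl, rfl, rfl, fun i a => ?_, fun a => rfl⟩,
    ⟨⟨by simp, by simp, by simp⟩, by simp, by simp, ?_⟩, fun _ => rfl, fun _ _ => rfl, fun _ => rfl,
    ?_, ?_, ?_⟩
  · simp [Block.run, inputState]
  · rw [hrem]
    exact ⟨⟨0, hm⟩, Finset.mem_univ _⟩
  · rw [hrem]
    simp [Block.run, SumExpr.lt, SumExpr.eval, inputState]
    omega
  · rw [hrem]
    simp [Block.run, SumExpr.lt, SumExpr.eval, inputState]
    omega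
  · simp [Block.run, inputState]

theorem exec_degreeProgram (P : Profile (Fin n) (Fin m)) {k : ℕ} (hn : 1 ≤ n) (hm : 1 ≤ m)
    (hk : 1 ≤ k) : ∃ (steps : ℕ) (s : State) (r : Option (SimpleGraph (Fin m))),
      Exec degreeProgram (inputState P k) steps s ∧ steps ≤ degreeProgramCost.eval (n + m) ∧
        Presents s r ∧ DegreeAlgorithmReturns P k r := by
  have : Nonempty (Fin n) := ⟨⟨0, hn⟩⟩
  have : Nonempty (Fin m) := ⟨⟨0, hm⟩⟩
  have h0 : (inputState P k).reg 0 ≤ n + m := Nat.le_add_right n m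
  have h1 : (inputState P k).reg 1 ≤ n + m := Nat.le_add_left m n
  have hA := (Block.assign 3 (lt (const 1) (reg 1))).simulates
    (by simp [Block.Valid, SumExpr.Valid, SumExpr.lt]) h0 h1
  obtain ⟨s₁, μ₁, hsim₁, hI₁, h3₁, h0₁, h1₁⟩ := Block.simulates_loop removalStep_valid (x := 3)
    (by omega) (fun μ s hI h3 => RemovalInvariant.step hn hI h3) (removalInvariant_inputState P k hm)
    h0 h1
  have h0' : s₁.reg 0 ≤ n + m := h0₁.trans_le h0
  have h1' : s₁.reg 1 ≤ n + m := h1₁.trans_le h1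
  have hB := (Block.assign 3 (not (reg 4))).simulates
    (by simp [Block.Valid, SumExpr.Valid, SumExpr.not]) h0' h1'
  obtain ⟨s₂, μ₂, hsim₂, hI₂, h3₂, h0₂, h1₂⟩ := Block.simulates_loop pushStep_valid (x := 3)
    (by omega) (fun μ s hI h3 => PushInvariant.step hn hk hI h3) (hI₁.pushInvariant hn h3₁)
    h0' h1'
  have h0'' : s₂.reg 0 ≤ n + m := h0₂.trans_le h0'
  have h1'' : s₂.reg 1 ≤ n + m := h1₂.trans_le h1'
  have hC := (Block.seq (.assign 5 (const 0)) (.assign 3 (not (reg 4)))).simulates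
    (by simp [Block.Valid, SumExpr.Valid, SumExpr.not]) h0'' h1''
  obtain ⟨s₃, μ₃, hsim₃, hI₃, h3₃, -, -⟩ := Block.simulates_loop outputStep_valid (x := 3)
    (by omega) (fun μ s hI h3 => OutputInvariant.step hI h3) (hI₂.outputInvariant hk hm h3₂)
    h0'' h1''
  obtain ⟨c₁, q₁, he₁, hc₁, ha₁⟩ := hA _ (AgreeBelow.refl _ _)
  obtain ⟨c₂, q₂, he₂, hc₂, ha₂⟩ := hsim₁ _ ha₁
  obtain ⟨c₃, q₃, he₃, hc₃, ha₃⟩ := hB _ ha₂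
  obtain ⟨c₄, q₄, he₄, hc₄, ha₄⟩ := hsim₂ _ ha₃
  obtain ⟨c₅, q₅, he₅, hc₅, ha₅⟩ := hC _ ha₄
  obtain ⟨c₆, q₆, he₆, hc₆, ha₆⟩ := hsim₃ _ ha₅
  have hex : Exec degreeProgram (inputState P k) _ _ :=
    .seq he₁ (.seq he₂ (.seq he₃ (.seq he₄ (.seq he₅ (.seq he₆ (.assign _ _ _))))))
  -- The simulation ignores only registers from `32` on, so the failure flag of the machine is the
  -- one in the invariant.
  have h4 := ha₆.2 4 (by omega)
  have hpres : ∃ r, Presents (q₆.setReg 0 ((Expr.sub (.const 1) (.reg 4)).eval q₆)) r ∧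
      DegreeAlgorithmReturns P k r := by
    rcases hI₃ with ⟨hf, -, hemp⟩ | ⟨hf, ord, t, F, T, -, -, -, hT, hadj, hout, -, hm5⟩
    · refine ⟨none, ?_, degreeAlgorithmReturns_none hk hemp⟩
      simp only [Presents, State.setReg_reg, if_true, Expr.eval]
      omega
    · refine ⟨some T, ⟨?_, fun a b => ?_⟩, degreeAlgorithmReturns_some hk hT⟩
      · simp only [State.setReg_reg, if_true, Expr.eval]
        omega
      · have hm5 := hm5 h3₃
        have hlt : ∀ a : Fin m, (a : ℕ) < s₃.reg 5 := fun a => a.2.trans_le hm5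
        rw [State.setReg_arr, ← ha₆.1, hout a b, hadj]
        simp only [hlt, true_and]
        exact ⟨fun h => if_pos h, fun h => if_neg h⟩
  obtain ⟨r, hr, hret⟩ := hpres
  refine ⟨_, _, r, hex, ?_, hr, hret⟩
  have hx : (m + 1) * ((removalStep.cost).eval (n + m) + 2) ≤
      (n + m + 1) * ((removalStep.cost).eval (n + m) + 2) := by gcongr; omega
  have hy : ((m + 1) * (m * m) + 1 + 1) * ((pushStep.cost).eval (n + m) + 2) ≤
      ((n + m + 1) * ((n + m) * (n + m)) + 2) * ((pushStep.cost).eval (n + m) + 2) := by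
    have : (m + 1) * (m * m) ≤ (n + m + 1) * ((n + m) * (n + m)) := by gcongr <;> omega
    exact Nat.mul_le_mul_right _ (by omega)
  have hz : (m + 1) * ((outputStep.cost).eval (n + m) + 2) ≤
      (n + m + 1) * ((outputStep.cost).eval (n + m) + 2) := by gcongr; omega
  simp only [degreeProgramCost, Polynomial.eval_add, Polynomial.eval_mul, Polynomial.eval_X,
    Polynomial.eval_one, Polynomial.eval_ofNat, Expr.cost]
  omega

end SinglePeakedTree

theorem mainTheorem9 :
    -- correctness of the algorithm, and the correspondence between trees and integral flows
    (∀ (N : Type*) (C : Type*) [Fintype N] [Nonempty N] [Fintype C] [Nonempty C]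
      (P : Profile N C) (k : ℕ), 1 ≤ k →
      ((∃ D, P.IsAttachmentDigraph D) ↔ P.trees.Nonempty) ∧
      (∀ D, P.IsAttachmentDigraph D →
        (∃! t, IsSink D t) ∧
        ∀ t, IsSink D t →
          ∃ e : fullFlows D t k ≃ P.treesMaxDegree k,
            ∀ g : fullFlows D t k, ∃ f, ReadOff D t k g.1 f ∧ (e g).1 = treeOf t f) ∧
      (∃ r, DegreeAlgorithmReturns P k r) ∧
      (∀ T, DegreeAlgorithmReturns P k (some T) → T ∈ P.treesMaxDegree k) ∧
      (DegreeAlgorithmReturns P k none → ¬ (P.treesMaxDegree k).Nonempty)) ∧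
    -- polynomial running time
    (∃ (prog : Program) (p : Polynomial ℕ),
      ∀ (n m : ℕ) (P : Profile (Fin n) (Fin m)) (k : ℕ), 1 ≤ n → 1 ≤ m → 1 ≤ k →
        ∃ (steps : ℕ) (s : State) (r : Option (SimpleGraph (Fin m))),
          Exec prog (inputState P k) steps s ∧ steps ≤ p.eval (n + m) ∧
          Presents s r ∧ DegreeAlgorithmReturns P k r) := by
  refine ⟨?_, degreeProgram, degreeProgramCost, fun n m P k hn hm hk =>
    exec_degreeProgram P hn hm hk⟩
  intro N C _ _ _ _ P k hk
  refine ⟨exists_isAttachmentDigraph_iff P, fun D hD => ⟨hD.existsUnique_sink, fun t ht =>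
    (hD.orientsTrees ht).exists_equiv hk⟩, ?_, fun T hT => hT.mem_treesMaxDegree hk,
    fun h => h.treesMaxDegree_eq_empty hk⟩
  by_cases h : (P.treesMaxDegree k).Nonempty
  · obtain ⟨T, hT⟩ := h
    exact ⟨some T, degreeAlgorithmReturns_some hk hT⟩
  · exact ⟨none, degreeAlgorithmReturns_none hk h⟩
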